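/- Let $\kappa\in\mathbb R$ and let $M_\kappa^2$ be the simply connected complete surface of constant curvature $\kappa$ (the hyperbolic plane with its distance multiplied by $1/\sqrt{-\kappa}$ if $\kappa<0$, the Euclidean plane if $\kappa=0$, the unit sphere with its intrinsic distance multiplied by $1/\sqrt{\kappa}$ if $\kappa>0$). A \emph{geodesic triangle} in $M_\kappa^2$ is given by three points $A,B,C$, not on a common geodesic line and, if $\kappa>0$, lying in a common open hemisphere; its sides $a=BC$, $b=CA$, $c=AB$ are the minimal geodesic segments between its vertices, and $\alpha,\beta,\gamma$ are its angles at $A,B,C$. Let $D,E,F$ be the midpoints of $BC$, $CA$, $AB$. The medial subdivision of $ABC$ consists of the four triangles with labelled vertices $(A',B',C')$ equal to $(D,E,F)$, $(A,F,E)$, $(F,B,D)$ or $(E,D,C)$. A \emph{nested sequence} is a sequence of labelled triangles $t_0,t_1,t_2,\dots$ such that $t_0$ is a geodesic triangle and, for every $n$, $t_{n+1}$ is one of the four labelled triangles of the medial subdivision of $t_n$. Write $\alpha_n,\beta_n,\gamma_n$ for the angles of $t_n$ at its vertices $A_n,B_n,C_n$. \textbf{Theorem B.} For every geodesic triangle $t_0$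 in $M_\kappa^2$ there are constants $l_\alpha=l_\alpha(t_0)>0$ and $L_\alpha=L_\alpha(t_0)>0$ such that, for every nested sequence $t_0,t_1,\dots$ starting with $t_0$ and every $n\in\mathbb N$, \[ \alpha_0\cdot l_\alpha<\alpha_n<\alpha_0\cdot L_\alpha , \] and likewise for $\beta_n$ and $\gamma_n$ with constants $l_\beta,L_\beta$ and $l_\gamma,L_\gamma$. Moreover these constants can be chosen so that the lower ones tend to $1$ from below and the upper ones tend to $1$ from above as all side lengths of $t_0$ tend to $0$: for every $\varepsilon>0$ there is $\delta>0$ such that, whenever all side lengths of $t_0$ are less than $\delta$, we have $1-\varepsilon<l_\alpha(t_0)<1<L_\alpha(t_0)<1+\varepsilon$, and likewise for $\beta$ and $\gamma$. -/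

import Mathlib

noncomputable section

namespace MedialSubdivision

/-- The data of a plane geometry used below: its points, its distance function, the angle
`angle q p r` at `p` between the minimal geodesics from `p` to `q` and from `p` to `r`, and which
labelled triples of points are vertices of a (non-degenerate) geodesic triangle.
It is only ever used for the three geometries constructed below and their rescalings. -/
structure PlaneGeometry where
  Point : Type
  dist : Point → Point → ℝ
  angle : Point → Point → Point → ℝ
  IsTriangle : (Fin 3 → Point) → Prop

/-! ### The hyperbolic plane (hyperboloid model) -/

/-- The Lorentz form on `ℝ³`. -/
def lorentz (x y : Fin 3 → ℝ) : ℝ := x 0 * y 0 + x 1 * y 1 - x 2 * y 2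

/-- The upper sheet of the hyperboloid. -/
abbrev Hyperboloid : Type := {x : Fin 3 → ℝ // lorentz x x = -1 ∧ 0 < x 2}

/-- The Lorentz-orthogonal projection of `q` to the tangent plane at `p`. For `q ≠ p` this is a
positive multiple of the initial velocity of the geodesic from `p` to `q`. -/
def hypDir (p q : Hyperboloid) : Fin 3 → ℝ := q.1 + lorentz p.1 q.1 • p.1

/-- The hyperbolic plane of curvature `-1`. Triangles are triples of points which do not lie on a
common geodesic line, the lines being the sections of the hyperboloid by planes through `0`. -/
def hyperbolicPlane : PlaneGeometry where
  Point := Hyperboloid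
  dist p q := Real.arcosh (-lorentz p.1 q.1)
  angle q p r := Real.arccos (lorentz (hypDir p q) (hypDir p r) /
    (√(lorentz (hypDir p q) (hypDir p q)) * √(lorentz (hypDir p r) (hypDir p r))))
  IsTriangle t := LinearIndependent ℝ fun i => (t i).1

/-! ### The Euclidean plane -/

/-- The Euclidean plane. -/
def euclideanPlane : PlaneGeometry where
  Point := EuclideanSpace ℝ (Fin 2)
  dist p q := Dist.dist p q
  angle q p r := EuclideanGeometry.angle q p r
  IsTriangle t := AffineIndependent ℝ t

/-! ### The sphere -/

/-- The unit sphere of `ℝ³`. -/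
abbrev Sphere2 : Type := Metric.sphere (0 : EuclideanSpace ℝ (Fin 3)) 1

/-- The orthogonal projection of `q` to the tangent plane at `p`. For `q ≠ ± p` this is a positive
multiple of the initial velocity of the minimal geodesic from `p` to `q`. -/
def sphDir (p q : Sphere2) : EuclideanSpace ℝ (Fin 3) := q.1 - inner ℝ p.1 q.1 • p.1

/-- The sphere of curvature `1` with its intrinsic distance. Triangles are triples of points in a
common open hemisphere which do not lie on a common great circle. -/
def unitSphere : PlaneGeometry where
  Point := Sphere2
  dist p q := InnerProductGeometry.angle p.1 q.1
  angle q p r := InnerProductGeometry.angle (sphDir p q) (sphDir p r)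
  IsTriangle t := LinearIndependent ℝ (fun i => (t i).1) ∧
    ∃ v : EuclideanSpace ℝ (Fin 3), ∀ i, 0 < inner ℝ v (t i).1

/-! ### The surfaces of constant curvature -/

/-- Multiply the distance function by `c`. -/
def PlaneGeometry.rescale (c : ℝ) (M : PlaneGeometry) : PlaneGeometry :=
  { M with dist := fun p q => c * M.dist p q }

/-- The simply connected surface of constant curvature `κ`. -/
def constCurv (κ : ℝ) : PlaneGeometry :=
  if κ < 0 then hyperbolicPlane.rescale (1 / √(-κ))
  else if κ = 0 then euclideanPlane
  else unitSphere.rescale (1 / √κ)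

/-! ### The medial subdivision -/

namespace PlaneGeometry

variable (M : PlaneGeometry)

/-- `m` is the midpoint of `p` and `q`. -/
def IsMidpoint (m p q : M.Point) : Prop :=
  M.dist p m = M.dist p q / 2 ∧ M.dist m q = M.dist p q / 2

/-- The angle of the triangle `t` at its vertex `i`. -/
def vertexAngle (t : Fin 3 → M.Point) (i : Fin 3) : ℝ :=
  M.angle (t (i + 1)) (t i) (t (i + 2))

/-- `t'` is the innermost triangle of the medial subdivision of `t`; its vertex `i` is the midpoint
of the side of `t` opposite to the vertex `i`, so that its side `i` (the one opposite to vertex `i`)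
is the one which does not meet the side `i` of `t`. -/
def IsInner (t t' : Fin 3 → M.Point) : Prop :=
  ∀ i, M.IsMidpoint (t' i) (t (i + 1)) (t (i + 2))

/-- `t'` is the outer triangle of the medial subdivision of `t` at the vertex `k`; its two sides
through `t k` keep the label of the side of `t` in which they are contained. -/
def IsOuter (k : Fin 3) (t t' : Fin 3 → M.Point) : Prop :=
  t' k = t k ∧ ∀ i, i ≠ k → M.IsMidpoint (t' i) (t k) (t i)

/-- `t 0, t 1, …` is a nested sequence of labelled subdivision triangles. -/
def IsNested (t : ℕ → Fin 3 → M.Point) : Prop :=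
  M.IsTriangle (t 0) ∧
    ∀ n, M.IsInner (t n) (t (n + 1)) ∨ ∃ k, M.IsOuter k (t n) (t (n + 1))

end PlaneGeometry

end MedialSubdivision

end

/-!
In curvature `±1` the angle of a triangle at a vertex is the inverse cotangent of
`(u - v * w) / √G`, where `u`, `v`, `w` are the values of `cos` (or `cosh`) at its sides and `G` is
the Gram determinant of its vertices. The cosines of the sides of the four subdivision triangles
are explicit functions of `u`, `v`, `w`, and a subdivision step changes this cotangent only by an
error which is at most a multiple of `√(1 + cot²)` times the size `|1 - u| + |1 - v| + |1 - w|`.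
So the logarithm of the angle moves by at most a multiple of the size, and as the size of a small
triangle decreases geometrically along a nested sequence, these changes add up to at most a
multiple of the initial size.

A large triangle has to become small first. The sides of a hyperbolic triangle shrink by
themselves; on the sphere, a gnomonic projection turns a subdivision step into one that takes convex
combinations with weights bounded away from `0`, so that the Euclidean diameter contracts. Hence
the sequence reaches the small triangles after a number of steps that depends on `t₀` only, and the
finitely many triangles that occur until then change the angles by a bounded factor.
-/

noncomputable section

namespace MedialSubdivision

open Real

/-- The inverse cotangent with values in `(0, π)`. -/
def arccot (x : ℝ) : ℝ := π / 2 - arctan x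

theorem arccot_pos (x : ℝ) : 0 < arccot x := sub_pos.2 (arctan_lt_pi_div_two x)

theorem arccot_div_sqrt {R : ℝ} (hR : 0 < R) (x : ℝ) :
    arccot (x / √R) = arccos (x / √(x ^ 2 + R)) := by
  have h : √(x ^ 2 + R) = √R * √(1 + (x / √R) ^ 2) := by
    rw [← sqrt_mul hR.le, div_pow, sq_sqrt hR.le]
    congr 1
    field_simp
    ring
  rw [arccot, arctan_eq_arcsin, arccos, h, div_div]

theorem hasDerivAt_arccot (x : ℝ) : HasDerivAt arccot (-(1 / (1 + x ^ 2))) x :=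
  (hasDerivAt_arctan x).const_sub (π / 2)

theorem inv_sqrt_one_add_sq_le_arccot (x : ℝ) : (√(1 + x ^ 2))⁻¹ ≤ arccot x := by
  rw [← one_div, ← cos_arctan, ← sin_pi_div_two_sub]
  exact sin_le (arccot_pos x).le

theorem hasDerivAt_log_arccot (x : ℝ) :
    HasDerivAt (fun z => log (arccot z)) (-(1 / (1 + x ^ 2)) / arccot x) x :=
  (hasDerivAt_arccot x).log (arccot_pos x).ne'

theorem abs_deriv_log_arccot_le (x : ℝ) :
    |-(1 / (1 + x ^ 2)) / arccot x| ≤ (√(1 + x ^ 2))⁻¹ := by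
  rw [abs_div, abs_neg, abs_of_pos (by positivity), abs_of_pos (arccot_pos x),
    div_le_iff₀ (arccot_pos x)]
  calc 1 / (1 + x ^ 2) = (√(1 + x ^ 2))⁻¹ * (√(1 + x ^ 2))⁻¹ := by
        rw [← mul_inv, mul_self_sqrt (by positivity), one_div]
    _ ≤ (√(1 + x ^ 2))⁻¹ * arccot x := by
        gcongr
        exact inv_sqrt_one_add_sq_le_arccot x

theorem sqrt_one_add_sq_le_two_mul {x z : ℝ} (h : |z - x| ≤ √(1 + x ^ 2) / 2) :
    √(1 + x ^ 2) ≤ 2 * √(1 + z ^ 2) := by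
  have hx : √(1 + x ^ 2) ^ 2 = 1 + x ^ 2 := sq_sqrt (by positivity)
  have hzx : (z - x) ^ 2 ≤ (√(1 + x ^ 2) / 2) ^ 2 := sq_le_sq' (neg_le_of_abs_le h) (le_of_abs_le h)
  rw [← sqrt_sq zero_le_two, ← sqrt_mul (sq_nonneg 2)]
  refine sqrt_le_sqrt ?_
  nlinarith [sq_nonneg (x - 2 * (x - z))]

theorem abs_log_arccot_sub_le {x y η : ℝ} (hη : η ≤ 1 / 2) (h : |y - x| ≤ η * √(1 + x ^ 2)) :
    |log (arccot y) - log (arccot x)| ≤ 2 * η := by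
  have hr : 0 < √(1 + x ^ 2) := by positivity
  have hderiv : ∀ z ∈ Set.uIcc x y,
      ‖-(1 / (1 + z ^ 2)) / arccot z‖ ≤ 2 / √(1 + x ^ 2) := fun z hz => by
    have hzx : |z - x| ≤ √(1 + x ^ 2) / 2 := calc
      |z - x| ≤ |y - x| := Set.abs_sub_left_of_mem_uIcc hz
      _ ≤ η * √(1 + x ^ 2) := h
      _ ≤ √(1 + x ^ 2) / 2 := by nlinarith
    refine (abs_deriv_log_arccot_le z).trans ?_
    rw [inv_le_comm₀ (by positivity) (by positivity), inv_div]
    linarith [sqrt_one_add_sq_le_two_mul hzx]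
  have hmvt := (convex_uIcc x y).norm_image_sub_le_of_norm_hasDerivWithin_le
    (fun z _ => (hasDerivAt_log_arccot z).hasDerivWithinAt) hderiv Set.left_mem_uIcc
    Set.right_mem_uIcc
  calc |log (arccot y) - log (arccot x)| ≤ 2 / √(1 + x ^ 2) * |y - x| := hmvt
    _ ≤ 2 / √(1 + x ^ 2) * (η * √(1 + x ^ 2)) := by gcongr
    _ = 2 * η := by field_simp

theorem abs_log_arccot_div_sqrt_sub_le {x y R η : ℝ} (hR : 0 < R) (hη : η ≤ 1 / 2)
    (h : |y - x| ≤ η * √(x ^ 2 + R)) :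
    |log (arccot (y / √R)) - log (arccot (x / √R))| ≤ 2 * η := by
  refine abs_log_arccot_sub_le hη ?_
  have hsqrt : √(1 + (x / √R) ^ 2) = √(x ^ 2 + R) / √R := by
    rw [← sqrt_div' _ hR.le, div_pow, sq_sqrt hR.le]
    congr 1
    field_simp
    ring
  rw [← sub_div, abs_div, abs_of_nonneg (sqrt_nonneg R), hsqrt, ← mul_div_assoc]
  gcongr

section Orbit

variable {ι τ E : Type*} [PseudoMetricSpace E] {step : ι → τ → τ} {S : Set τ} {f : τ → E}
  {Φ : τ → ℝ} {s : ℕ → τ}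

/-- A sequence each of whose terms is obtained from the preceding one by some map of the family
`step`. -/
def IsOrbit (step : ι → τ → τ) (s : ℕ → τ) : Prop :=
  ∀ n, ∃ k, s (n + 1) = step k (s n)

theorem IsOrbit.shift (hs : IsOrbit step s) (m : ℕ) : IsOrbit step fun n => s (m + n) :=
  fun n => hs (m + n)

theorem IsOrbit.mem (hs : IsOrbit step s) (hS : ∀ t ∈ S, ∀ k, step k t ∈ S) (h₀ : s 0 ∈ S) :
    ∀ n, s n ∈ S
  | 0 => h₀
  | n + 1 => by
    obtain ⟨k, hk⟩ := hs n
    exact hk ▸ hS _ (hs.mem hS h₀ n) k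

theorem IsOrbit.dist_le (hs : IsOrbit step s) (hS : ∀ t ∈ S, ∀ k, step k t ∈ S)
    (hf : ∀ t ∈ S, ∀ k, dist (f t) (f (step k t)) ≤ Φ t - Φ (step k t)) (h₀ : s 0 ∈ S) (n : ℕ) :
    dist (f (s 0)) (f (s n)) ≤ Φ (s 0) - Φ (s n) := by
  induction n with
  | zero => simp
  | succ n ih =>
    obtain ⟨k, hk⟩ := hs n
    have hstep := hf _ (hs.mem hS h₀ n) k
    rw [← hk] at hstep
    linarith [dist_triangle (f (s 0)) (f (s n)) (f (s (n + 1)))]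

theorem finite_setOf_isOrbit_apply [Finite ι] (step : ι → τ → τ) (t : τ) (n : ℕ) :
    {x | ∃ s, IsOrbit step s ∧ s 0 = t ∧ s n = x}.Finite := by
  induction n with
  | zero =>
    refine (Set.finite_singleton t).subset ?_
    rintro _ ⟨s, -, h₀, rfl⟩
    exact h₀
  | succ n ih =>
    refine (Set.finite_iUnion fun k => ih.image (step k)).subset ?_
    rintro _ ⟨s, hs, h₀, rfl⟩
    obtain ⟨k, hk⟩ := hs n
    exact Set.mem_iUnion.2 ⟨k, s n, ⟨s, hs, h₀, rfl⟩, hk.symm⟩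

theorem exists_forall_isOrbit_dist_le [Finite ι] {t : τ} {b : ℝ} {N : ℕ}
    (hS : ∀ t ∈ S, ∀ k, step k t ∈ S)
    (hf : ∀ t ∈ S, ∀ k, dist (f t) (f (step k t)) ≤ Φ t - Φ (step k t))
    (hΦ : ∀ t ∈ S, 0 ≤ Φ t) (hb : ∀ t ∈ S, Φ t ≤ b)
    (hN : ∀ s, IsOrbit step s → s 0 = t → s N ∈ S) :
    ∃ K, ∀ s, IsOrbit step s → s 0 = t → ∀ n, dist (f t) (f (s n)) ≤ K := by
  have hfin : (⋃ m ∈ Set.Iic N, {x | ∃ s, IsOrbit step s ∧ s 0 = t ∧ s m = x}).Finite :=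
    (Set.finite_Iic N).biUnion fun m _ => finite_setOf_isOrbit_apply step t m
  obtain ⟨C, hC⟩ := (hfin.image fun x => dist (f t) (f x)).bddAbove
  have hhead : ∀ s, IsOrbit step s → s 0 = t → ∀ m ≤ N, dist (f t) (f (s m)) ≤ C :=
    fun s hs h₀ m hm => hC ⟨s m, Set.mem_biUnion hm ⟨s, hs, h₀, rfl⟩, rfl⟩
  refine ⟨C + max b 0, fun s hs h₀ n => ?_⟩
  obtain hn | ⟨m, rfl⟩ := (le_total n N).imp_right Nat.exists_eq_add_of_le
  · linarith [hhead s hs h₀ n hn, le_max_right b 0]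
  · have hNS := hN s hs h₀
    have htail : dist (f (s N)) (f (s (N + m))) ≤ Φ (s N) - Φ (s (N + m)) :=
      (hs.shift N).dist_le hS hf hNS m
    have hmS := (hs.shift N).mem hS hNS m
    linarith [dist_triangle (f t) (f (s N)) (f (s (N + m))), hhead s hs h₀ N le_rfl,
      hb _ hNS, hΦ _ hmS, le_max_left b 0]

end Orbit

section Sides

/-- The Gram determinant of three unit vectors with mutual inner products `u`, `v`, `w`. -/
def gram (u v w : ℝ) : ℝ := 1 + 2 * u * v * w - u ^ 2 - v ^ 2 - w ^ 2

/-- `cos (x / 2)` when `w = cos x`, and `cosh (x / 2)` when `w = cosh x`. -/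
def halfSide (w : ℝ) : ℝ := √((1 + w) / 2)

/-- The `cos` or `cosh` of the segment between the midpoints of two sides of a triangle, where `v`
and `w` are the `cos` or `cosh` of these two sides and `u` that of the third side. -/
def midline (u v w : ℝ) : ℝ := (1 + u + v + w) / (4 * halfSide v * halfSide w)

/-- The angle opposite to the first side of a triangle whose sides have the cosines (if `σ = 1`) or
hyperbolic cosines (if `σ = -1`) `u`, `v`, `w`, as given by the law of cosines. -/
def cosineLawAngle (σ u v w : ℝ) : ℝ :=
  arccos (σ * (u - v * w) / (√(σ * (1 - v ^ 2)) * √(σ * (1 - w ^ 2))))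

/-- Up to the factor `2` and for small triangles, the sum of the squares of the sides of a triangle
whose sides have the cosines (if `σ = 1`) or hyperbolic cosines (if `σ = -1`) `u`, `v`, `w`. -/
def sidesSize (σ u v w : ℝ) : ℝ := σ * (1 - u) + σ * (1 - v) + σ * (1 - w)

/-- `w` is the cosine of a length in `(0, π)` if `σ = 1`, and the hyperbolic cosine of a positive
length if `σ = -1`. -/
structure IsSideCos (σ w : ℝ) : Prop where
  mul_one_sub_pos : 0 < σ * (1 - w)
  one_add_pos : 0 < 1 + w

/-- `u`, `v`, `w` are the cosines (if `σ = 1`) or hyperbolic cosines (if `σ = -1`) of the sides of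
a nondegenerate triangle. -/
structure IsTriangleSides (σ u v w : ℝ) : Prop where
  sign : σ = 1 ∨ σ = -1
  fst : IsSideCos σ u
  snd : IsSideCos σ v
  thd : IsSideCos σ w
  gram_pos : 0 < gram u v w

variable {σ u v w : ℝ}

theorem gram_rotate (u v w : ℝ) : gram v w u = gram u v w := by unfold gram; ring

theorem gram_swap (u v w : ℝ) : gram u w v = gram u v w := by unfold gram; ring

theorem midline_swap (u v w : ℝ) : midline u w v = midline u v w := by unfold midline; ring

theorem cosineLawAngle_swap (σ u v w : ℝ) : cosineLawAngle σ u w v = cosineLawAngle σ u v w := by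
  unfold cosineLawAngle
  rw [mul_comm w v, mul_comm (√(σ * (1 - w ^ 2)))]

theorem sidesSize_rotate (σ u v w : ℝ) : sidesSize σ v w u = sidesSize σ u v w := by
  unfold sidesSize; ring

theorem sidesSize_swap (σ u v w : ℝ) : sidesSize σ u w v = sidesSize σ u v w := by
  unfold sidesSize; ring

theorem IsTriangleSides.rotate (h : IsTriangleSides σ u v w) : IsTriangleSides σ v w u :=
  ⟨h.sign, h.snd, h.thd, h.fst, (gram_rotate u v w).symm ▸ h.gram_pos⟩

theorem IsTriangleSides.swap (h : IsTriangleSides σ u v w) : IsTriangleSides σ u w v :=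
  ⟨h.sign, h.fst, h.thd, h.snd, (gram_swap u v w).symm ▸ h.gram_pos⟩

theorem IsTriangleSides.sidesSize_pos (h : IsTriangleSides σ u v w) : 0 < sidesSize σ u v w :=
  add_pos (add_pos h.fst.mul_one_sub_pos h.snd.mul_one_sub_pos) h.thd.mul_one_sub_pos

theorem halfSide_pos (hw : 0 < 1 + w) : 0 < halfSide w := sqrt_pos.2 (half_pos hw)

theorem halfSide_two_mul_sq_sub_one {c : ℝ} (hc : 0 ≤ c) : halfSide (2 * c ^ 2 - 1) = c := by
  rw [halfSide, show (1 + (2 * c ^ 2 - 1)) / 2 = c ^ 2 by ring, sqrt_sq hc]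

theorem exists_eq_two_mul_sq_sub_one (hw : 0 < 1 + w) : ∃ c, 0 < c ∧ w = 2 * c ^ 2 - 1 := by
  refine ⟨halfSide w, halfSide_pos hw, ?_⟩
  rw [halfSide, sq_sqrt (half_pos hw).le]
  ring

theorem midline_two_mul_sq_sub_one {a b c : ℝ} (hb : 0 ≤ b) (hc : 0 ≤ c) :
    midline (2 * a ^ 2 - 1) (2 * b ^ 2 - 1) (2 * c ^ 2 - 1) =
      (a ^ 2 + b ^ 2 + c ^ 2 - 1) / (2 * b * c) := by
  rw [midline, halfSide_two_mul_sq_sub_one hb, halfSide_two_mul_sq_sub_one hc,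
    ← mul_div_mul_left _ (2 * b * c) two_ne_zero]
  ring

theorem IsSideCos.mul_one_sub_sq_pos (h : IsSideCos σ w) : 0 < σ * (1 - w ^ 2) := by
  rw [show σ * (1 - w ^ 2) = σ * (1 - w) * (1 + w) by ring]
  exact mul_pos h.mul_one_sub_pos h.one_add_pos

protected theorem IsSideCos.halfSide (hσ : σ = 1 ∨ σ = -1) (h : IsSideCos σ w) :
    IsSideCos σ (halfSide w) := by
  obtain ⟨c, hc, rfl⟩ := exists_eq_two_mul_sq_sub_one h.one_add_pos
  rw [halfSide_two_mul_sq_sub_one hc.le]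
  have := h.mul_one_sub_pos
  refine ⟨?_, by linarith⟩
  rcases hσ with rfl | rfl <;> nlinarith

theorem IsSideCos.mul_one_sub_halfSide_le (hσ : σ = 1 ∨ σ = -1) (h : IsSideCos σ w) :
    σ * (1 - halfSide w) ≤ σ * (1 - w) / 2 := by
  have hhalf := (h.halfSide hσ).mul_one_sub_pos
  obtain ⟨c, hc, rfl⟩ := exists_eq_two_mul_sq_sub_one h.one_add_pos
  rw [halfSide_two_mul_sq_sub_one hc.le] at hhalf ⊢
  nlinarith

theorem IsSideCos.abs_halfSide_sub_one_le (hσ : σ = 1 ∨ σ = -1) (h : IsSideCos σ w) :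
    |halfSide w - 1| ≤ σ * (1 - w) / 2 := by
  have hpos := (h.halfSide hσ).mul_one_sub_pos
  have hle := h.mul_one_sub_halfSide_le hσ
  rcases hσ with rfl | rfl <;> exact abs_le.2 ⟨by linarith, by linarith⟩

theorem sq_one_add_add_add_gram (u v w : ℝ) :
    (1 + u + v + w) ^ 2 + gram u v w = 2 * (1 + u) * (1 + v) * (1 + w) := by
  unfold gram; ring

theorem IsTriangleSides.abs_midline_lt_halfSide (h : IsTriangleSides σ u v w) :
    |midline u v w| < halfSide u := by
  have hsum := sq_one_add_add_add_gram u v w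
  have hg := h.gram_pos
  obtain ⟨a, ha, rfl⟩ := exists_eq_two_mul_sq_sub_one h.fst.one_add_pos
  obtain ⟨b, hb, rfl⟩ := exists_eq_two_mul_sq_sub_one h.snd.one_add_pos
  obtain ⟨c, hc, rfl⟩ := exists_eq_two_mul_sq_sub_one h.thd.one_add_pos
  rw [midline_two_mul_sq_sub_one hb.le hc.le, halfSide_two_mul_sq_sub_one ha.le, abs_div,
    abs_of_pos (by positivity : 0 < 2 * b * c), div_lt_iff₀ (by positivity)]
  refine abs_lt_of_sq_lt_sq ?_ (by positivity)
  linarith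

theorem IsTriangleSides.isSideCos_midline (h : IsTriangleSides σ u v w) :
    IsSideCos σ (midline u v w) := by
  obtain ⟨hgt, hlt⟩ := abs_lt.1 h.abs_midline_lt_halfSide
  have hhalf := (h.fst.halfSide h.sign).mul_one_sub_pos
  rcases h.sign with rfl | rfl
  · exact ⟨by linarith, by linarith⟩
  suffices 1 < midline u v w from ⟨by linarith, by linarith⟩
  have hu := h.fst.mul_one_sub_pos
  obtain ⟨a, -, rfl⟩ := exists_eq_two_mul_sq_sub_one h.fst.one_add_pos
  obtain ⟨b, hb, rfl⟩ := exists_eq_two_mul_sq_sub_one h.snd.one_add_pos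
  obtain ⟨c, hc, rfl⟩ := exists_eq_two_mul_sq_sub_one h.thd.one_add_pos
  rw [midline_two_mul_sq_sub_one hb.le hc.le, one_lt_div (by positivity)]
  nlinarith [sq_nonneg (b - c)]

theorem IsTriangleSides.mul_one_sub_midline_le (h : IsTriangleSides σ u v w)
    (hvw : σ = 1 → 0 ≤ v + w) : σ * (1 - midline u v w) ≤ σ * (1 - u) / 2 := by
  have hlt := (abs_lt.1 h.abs_midline_lt_halfSide).2
  have hhalf := h.fst.mul_one_sub_halfSide_le h.sign
  rcases h.sign with rfl | rfl
  · replace hvw := hvw rfl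
    have hu := h.fst.mul_one_sub_pos
    obtain ⟨a, ha, rfl⟩ := exists_eq_two_mul_sq_sub_one h.fst.one_add_pos
    obtain ⟨b, hb, rfl⟩ := exists_eq_two_mul_sq_sub_one h.snd.one_add_pos
    obtain ⟨c, hc, rfl⟩ := exists_eq_two_mul_sq_sub_one h.thd.one_add_pos
    suffices a ^ 2 ≤ midline (2 * a ^ 2 - 1) (2 * b ^ 2 - 1) (2 * c ^ 2 - 1) by linarith
    rw [midline_two_mul_sq_sub_one hb.le hc.le, le_div_iff₀ (by positivity)]
    calc a ^ 2 * (2 * b * c) ≤ a ^ 2 * (b ^ 2 + c ^ 2) := by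
          gcongr
          exact two_mul_le_add_sq b c
      _ = a ^ 2 + a ^ 2 * (b ^ 2 + c ^ 2 - 1) := by ring
      _ ≤ a ^ 2 + 1 * (b ^ 2 + c ^ 2 - 1) := by gcongr <;> linarith
      _ = a ^ 2 + b ^ 2 + c ^ 2 - 1 := by ring
  · linarith

theorem gram_midline (hu : 0 < 1 + u) (hv : 0 < 1 + v) (hw : 0 < 1 + w) :
    gram (midline u v w) (midline v w u) (midline w u v) =
      (4 * halfSide u * halfSide v * halfSide w)⁻¹ ^ 2 * gram u v w := by
  obtain ⟨a, ha, rfl⟩ := exists_eq_two_mul_sq_sub_one hu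
  obtain ⟨b, hb, rfl⟩ := exists_eq_two_mul_sq_sub_one hv
  obtain ⟨c, hc, rfl⟩ := exists_eq_two_mul_sq_sub_one hw
  simp only [midline_two_mul_sq_sub_one, halfSide_two_mul_sq_sub_one, ha.le, hb.le, hc.le, gram]
  field_simp
  ring

theorem gram_midline_halfSide (hu : 0 < 1 + u) (hv : 0 < 1 + v) (hw : 0 < 1 + w) :
    gram (midline u v w) (halfSide v) (halfSide w) =
      (4 * halfSide v * halfSide w)⁻¹ ^ 2 * gram u v w := by
  obtain ⟨a, -, rfl⟩ := exists_eq_two_mul_sq_sub_one hu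
  obtain ⟨b, hb, rfl⟩ := exists_eq_two_mul_sq_sub_one hv
  obtain ⟨c, hc, rfl⟩ := exists_eq_two_mul_sq_sub_one hw
  simp only [midline_two_mul_sq_sub_one, halfSide_two_mul_sq_sub_one, hb.le, hc.le, gram]
  field_simp
  ring

theorem IsTriangleSides.inner (h : IsTriangleSides σ u v w) :
    IsTriangleSides σ (midline u v w) (midline v w u) (midline w u v) where
  sign := h.sign
  fst := h.isSideCos_midline
  snd := h.rotate.isSideCos_midline
  thd := h.rotate.rotate.isSideCos_midline
  gram_pos := by
    have ha := halfSide_pos h.fst.one_add_pos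
    have hb := halfSide_pos h.snd.one_add_pos
    have hc := halfSide_pos h.thd.one_add_pos
    have hg := h.gram_pos
    rw [gram_midline h.fst.one_add_pos h.snd.one_add_pos h.thd.one_add_pos]
    positivity

theorem IsTriangleSides.outer (h : IsTriangleSides σ u v w) :
    IsTriangleSides σ (midline u v w) (halfSide v) (halfSide w) where
  sign := h.sign
  fst := h.isSideCos_midline
  snd := h.snd.halfSide h.sign
  thd := h.thd.halfSide h.sign
  gram_pos := by
    have hb := halfSide_pos h.snd.one_add_pos
    have hc := halfSide_pos h.thd.one_add_pos
    have hg := h.gram_pos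
    rw [gram_midline_halfSide h.fst.one_add_pos h.snd.one_add_pos h.thd.one_add_pos]
    positivity

end Sides

section CosineLaw

variable {σ u v w u' v' w' k n p : ℝ}

theorem IsTriangleSides.sq_sign (h : IsTriangleSides σ u v w) : σ ^ 2 = 1 := by
  rcases h.sign with rfl | rfl <;> norm_num

theorem IsTriangleSides.cosineLawAngle_eq (h : IsTriangleSides σ u v w) :
    cosineLawAngle σ u v w = arccot (σ * (u - v * w) / √(gram u v w)) := by
  have hσ : σ ^ 2 = 1 := h.sq_sign
  rw [arccot_div_sqrt h.gram_pos, cosineLawAngle, ← sqrt_mul h.snd.mul_one_sub_sq_pos.le]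
  congr 3
  unfold gram
  linear_combination (1 - v ^ 2 - w ^ 2 + v ^ 2 * w ^ 2 - (u - v * w) ^ 2) * hσ

theorem IsTriangleSides.cosineLawAngle_pos (h : IsTriangleSides σ u v w) :
    0 < cosineLawAngle σ u v w :=
  h.cosineLawAngle_eq ▸ arccot_pos _

theorem IsTriangleSides.cosineLawAngle_of_gram_eq (h' : IsTriangleSides σ u' v' w') (hk : 0 < k)
    (hg : gram u' v' w' = k ^ 2 * gram u v w) (hn : u' - v' * w' = k * n) :
    cosineLawAngle σ u' v' w' = arccot (σ * n / √(gram u v w)) := by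
  rw [h'.cosineLawAngle_eq, hg, hn, sqrt_mul (sq_nonneg k), sqrt_sq hk.le, mul_left_comm,
    mul_div_mul_left _ _ hk.ne']

theorem IsTriangleSides.cosineLawAngle_inner (h : IsTriangleSides σ u v w) :
    cosineLawAngle σ (midline u v w) (midline v w u) (midline w u v) =
      arccot (σ * ((1 + u + v + w) / (4 * halfSide u) * (1 + u - v - w)) / √(gram u v w)) := by
  have hg := gram_midline h.fst.one_add_pos h.snd.one_add_pos h.thd.one_add_pos
  have hu := halfSide_pos h.fst.one_add_pos
  have hv := halfSide_pos h.snd.one_add_pos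
  have hw := halfSide_pos h.thd.one_add_pos
  refine h.inner.cosineLawAngle_of_gram_eq (by positivity) hg ?_
  obtain ⟨a, ha, rfl⟩ := exists_eq_two_mul_sq_sub_one h.fst.one_add_pos
  obtain ⟨b, hb, rfl⟩ := exists_eq_two_mul_sq_sub_one h.snd.one_add_pos
  obtain ⟨c, hc, rfl⟩ := exists_eq_two_mul_sq_sub_one h.thd.one_add_pos
  simp only [midline_two_mul_sq_sub_one, halfSide_two_mul_sq_sub_one, ha.le, hb.le, hc.le]
  field_simp
  ring

theorem IsTriangleSides.cosineLawAngle_outer (h : IsTriangleSides σ u v w) :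
    cosineLawAngle σ (midline u v w) (halfSide v) (halfSide w) = cosineLawAngle σ u v w := by
  have hg := gram_midline_halfSide h.fst.one_add_pos h.snd.one_add_pos h.thd.one_add_pos
  have hv := halfSide_pos h.snd.one_add_pos
  have hw := halfSide_pos h.thd.one_add_pos
  rw [h.cosineLawAngle_eq]
  refine h.outer.cosineLawAngle_of_gram_eq (by positivity) hg ?_
  obtain ⟨a, -, rfl⟩ := exists_eq_two_mul_sq_sub_one h.fst.one_add_pos
  obtain ⟨b, hb, rfl⟩ := exists_eq_two_mul_sq_sub_one h.snd.one_add_pos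
  obtain ⟨c, hc, rfl⟩ := exists_eq_two_mul_sq_sub_one h.thd.one_add_pos
  simp only [midline_two_mul_sq_sub_one, halfSide_two_mul_sq_sub_one, hb.le, hc.le]
  field_simp
  ring

theorem IsTriangleSides.cosineLawAngle_outer_adjacent (h : IsTriangleSides σ u v w) :
    cosineLawAngle σ (halfSide u) (halfSide v) (midline w u v) =
      arccot (σ * (halfSide v * (1 + u - v - w)) / √(gram u v w)) := by
  have hg := gram_midline_halfSide h.thd.one_add_pos h.fst.one_add_pos h.snd.one_add_pos
  rw [← gram_rotate, ← gram_rotate w u v] at hg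
  have hu := halfSide_pos h.fst.one_add_pos
  have hv := halfSide_pos h.snd.one_add_pos
  refine h.rotate.rotate.outer.rotate.cosineLawAngle_of_gram_eq (by positivity) hg ?_
  obtain ⟨a, ha, rfl⟩ := exists_eq_two_mul_sq_sub_one h.fst.one_add_pos
  obtain ⟨b, hb, rfl⟩ := exists_eq_two_mul_sq_sub_one h.snd.one_add_pos
  obtain ⟨c, -, rfl⟩ := exists_eq_two_mul_sq_sub_one h.thd.one_add_pos
  simp only [midline_two_mul_sq_sub_one, halfSide_two_mul_sq_sub_one, ha.le, hb.le]
  field_simp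
  ring

theorem IsTriangleSides.mul_one_sub_mul_one_sub_pos (h : IsTriangleSides σ u v w) :
    0 < (1 - v) * (1 - w) := by
  have := mul_pos h.snd.mul_one_sub_pos h.thd.mul_one_sub_pos
  linear_combination this + (1 - v) * (1 - w) * h.sq_sign

theorem IsTriangleSides.sq_one_add_sub_sub_le (h : IsTriangleSides σ u v w)
    (hu : σ * (1 - u) ≤ 1 / 2) :
    (1 + u - v - w) ^ 2 ≤ 5 * ((1 - v) * (1 - w)) := by
  have hvw := h.mul_one_sub_mul_one_sub_pos
  have hu' : -(1 - u) ≤ 1 / 2 := by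
    rcases h.sign with rfl | rfl <;> linarith [h.fst.mul_one_sub_pos]
  have hprod : -(1 - u) * ((1 - v) * (1 - w)) ≤ 1 / 2 * ((1 - v) * (1 - w)) := by gcongr
  have hg := h.gram_pos
  have hid : (1 + u - v - w) ^ 2 =
      4 * ((1 - v) * (1 - w)) - gram u v w - 2 * ((1 - u) * ((1 - v) * (1 - w))) := by
    unfold gram; ring
  linarith

theorem IsTriangleSides.three_mul_one_sub_mul_one_sub_le (h : IsTriangleSides σ u v w)
    (hm : sidesSize σ u v w ≤ 1 / 8) :
    3 * ((1 - v) * (1 - w)) ≤ (1 - v ^ 2) * (1 - w ^ 2) := by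
  have hvw := h.mul_one_sub_mul_one_sub_pos
  have hu := h.fst.mul_one_sub_pos
  have hv := h.snd.mul_one_sub_pos
  have hw := h.thd.mul_one_sub_pos
  unfold sidesSize at hm
  have hv' : 7 / 4 ≤ 1 + v := by rcases h.sign with rfl | rfl <;> linarith
  have hw' : 7 / 4 ≤ 1 + w := by rcases h.sign with rfl | rfl <;> linarith
  calc 3 * ((1 - v) * (1 - w)) ≤ 7 / 4 * (7 / 4) * ((1 - v) * (1 - w)) := by
        gcongr; norm_num
    _ ≤ (1 + v) * (1 + w) * ((1 - v) * (1 - w)) := by gcongr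
    _ = (1 - v ^ 2) * (1 - w ^ 2) := by ring

theorem IsTriangleSides.mul_one_sub_mul_one_sub_le (h : IsTriangleSides σ u v w)
    (hm : sidesSize σ u v w ≤ 1 / 8) :
    (1 - v) * (1 - w) ≤ sidesSize σ u v w * √((1 - v ^ 2) * (1 - w ^ 2)) := by
  have hvw := h.mul_one_sub_mul_one_sub_pos
  have hr := h.three_mul_one_sub_mul_one_sub_le hm
  have hm₀ := h.sidesSize_pos
  have hu := h.fst.mul_one_sub_pos
  have hv := h.snd.mul_one_sub_pos
  have hw := h.thd.mul_one_sub_pos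
  have hle : (1 - v) * (1 - w) ≤ sidesSize σ u v w ^ 2 := calc
    (1 - v) * (1 - w) = σ * (1 - v) * (σ * (1 - w)) := by
      linear_combination -(1 - v) * (1 - w) * h.sq_sign
    _ ≤ sidesSize σ u v w * sidesSize σ u v w := by unfold sidesSize; gcongr <;> linarith
    _ = sidesSize σ u v w ^ 2 := (sq _).symm
  refine (le_abs_self _).trans (abs_le_of_sq_le_sq ?_ (by positivity))
  rw [mul_pow (sidesSize σ u v w), sq_sqrt (by linarith), sq ((1 - v) * (1 - w))]
  exact mul_le_mul hle (by linarith) hvw.le (sq_nonneg _)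

theorem IsTriangleSides.abs_one_add_sub_sub_le (h : IsTriangleSides σ u v w)
    (hm : sidesSize σ u v w ≤ 1 / 8) :
    |1 + u - v - w| ≤ 3 / 2 * √((1 - v ^ 2) * (1 - w ^ 2)) := by
  have hvw := h.mul_one_sub_mul_one_sub_pos
  have hr := h.three_mul_one_sub_mul_one_sub_le hm
  have hu : σ * (1 - u) ≤ 1 / 2 := by
    unfold sidesSize at hm
    linarith [h.snd.mul_one_sub_pos, h.thd.mul_one_sub_pos]
  refine abs_le_of_sq_le_sq ?_ (by positivity)
  rw [mul_pow, sq_sqrt (by linarith)]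
  linarith [h.sq_one_add_sub_sub_le hu]

-- A subdivision step replaces the numerator `u - v * w` of the cotangent by
-- `p * (1 + u - v - w)`, where `p` is close to `1`.
theorem IsTriangleSides.abs_mul_one_add_sub_sub_sub_le (h : IsTriangleSides σ u v w)
    (hm : sidesSize σ u v w ≤ 1 / 8) (hp : |p - 1| ≤ sidesSize σ u v w) :
    |p * (1 + u - v - w) - (u - v * w)| ≤
      5 / 2 * sidesSize σ u v w * √((1 - v ^ 2) * (1 - w ^ 2)) := by
  have hm₀ := h.sidesSize_pos
  calc |p * (1 + u - v - w) - (u - v * w)|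
      = |(p - 1) * (1 + u - v - w) + (1 - v) * (1 - w)| := by congr 1; ring
    _ ≤ |p - 1| * |1 + u - v - w| + (1 - v) * (1 - w) := by
      rw [← abs_mul]
      exact (abs_add_le _ _).trans_eq (by rw [abs_of_pos h.mul_one_sub_mul_one_sub_pos])
    _ ≤ sidesSize σ u v w * (3 / 2 * √((1 - v ^ 2) * (1 - w ^ 2))) +
        sidesSize σ u v w * √((1 - v ^ 2) * (1 - w ^ 2)) :=
      add_le_add (mul_le_mul hp (h.abs_one_add_sub_sub_le hm) (abs_nonneg _) hm₀.le)
        (h.mul_one_sub_mul_one_sub_le hm)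
    _ = _ := by ring

theorem IsTriangleSides.abs_log_arccot_sub_le (h : IsTriangleSides σ u v w)
    (hm : sidesSize σ u v w ≤ 1 / 8) (hp : |p - 1| ≤ sidesSize σ u v w) :
    |log (arccot (σ * (p * (1 + u - v - w)) / √(gram u v w))) - log (cosineLawAngle σ u v w)| ≤
      5 * sidesSize σ u v w := by
  have hσ : |σ| = 1 := by rcases h.sign with rfl | rfl <;> norm_num
  have hR : (σ * (u - v * w)) ^ 2 + gram u v w = (1 - v ^ 2) * (1 - w ^ 2) := by
    unfold gram
    linear_combination (u - v * w) ^ 2 * h.sq_sign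
  rw [h.cosineLawAngle_eq]
  calc _ ≤ 2 * (5 / 2 * sidesSize σ u v w) := by
        refine abs_log_arccot_div_sqrt_sub_le h.gram_pos (by linarith) ?_
        rw [hR, ← mul_sub, abs_mul, hσ, one_mul]
        exact h.abs_mul_one_add_sub_sub_sub_le hm hp
    _ = 5 * sidesSize σ u v w := by ring

theorem IsTriangleSides.abs_log_cosineLawAngle_outer_adjacent_sub_le
    (h : IsTriangleSides σ u v w) (hm : sidesSize σ u v w ≤ 1 / 8) :
    |log (cosineLawAngle σ (halfSide u) (halfSide v) (midline w u v)) -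
      log (cosineLawAngle σ u v w)| ≤ 5 * sidesSize σ u v w := by
  rw [h.cosineLawAngle_outer_adjacent]
  refine h.abs_log_arccot_sub_le hm ((h.snd.abs_halfSide_sub_one_le h.sign).trans ?_)
  unfold sidesSize
  linarith [h.fst.mul_one_sub_pos, h.snd.mul_one_sub_pos, h.thd.mul_one_sub_pos]

theorem IsTriangleSides.abs_sum_div_halfSide_sub_one_le (h : IsTriangleSides σ u v w)
    (hm : sidesSize σ u v w ≤ 1 / 8) :
    |(1 + u + v + w) / (4 * halfSide u) - 1| ≤ sidesSize σ u v w := by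
  have hhalf := h.fst.abs_halfSide_sub_one_le h.sign
  have hu := h.fst.mul_one_sub_pos
  have hv := h.snd.mul_one_sub_pos
  have hw := h.thd.mul_one_sub_pos
  unfold sidesSize at hm ⊢
  obtain ⟨hgt, hlt⟩ := abs_le.1 hhalf
  obtain ⟨a, ha, rfl⟩ := exists_eq_two_mul_sq_sub_one h.fst.one_add_pos
  rw [halfSide_two_mul_sq_sub_one ha.le] at hgt hlt ⊢
  rw [div_sub_one (by positivity), abs_div, abs_of_pos (by positivity : 0 < 4 * a),
    div_le_iff₀ (by positivity), abs_le]
  rcases h.sign with rfl | rfl <;> constructor <;> nlinarith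

theorem IsTriangleSides.abs_log_cosineLawAngle_inner_sub_le (h : IsTriangleSides σ u v w)
    (hm : sidesSize σ u v w ≤ 1 / 8) :
    |log (cosineLawAngle σ (midline u v w) (midline v w u) (midline w u v)) -
      log (cosineLawAngle σ u v w)| ≤ 5 * sidesSize σ u v w := by
  rw [h.cosineLawAngle_inner]
  exact h.abs_log_arccot_sub_le hm (h.abs_sum_div_halfSide_sub_one_le hm)

theorem IsTriangleSides.add_nonneg_of_sidesSize_le (h : IsTriangleSides σ u v w)
    (hm : σ = 1 → sidesSize σ u v w ≤ 1) (hσ : σ = 1) : 0 ≤ v + w := by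
  have hu := h.fst.mul_one_sub_pos
  have hm' := hm hσ
  subst hσ
  unfold sidesSize at hm'
  linarith

theorem IsTriangleSides.sidesSize_outer_le (h : IsTriangleSides σ u v w)
    (hm : σ = 1 → sidesSize σ u v w ≤ 1) :
    sidesSize σ (midline u v w) (halfSide v) (halfSide w) ≤ sidesSize σ u v w / 2 := by
  have hu := h.mul_one_sub_midline_le (h.add_nonneg_of_sidesSize_le hm)
  have hv := h.snd.mul_one_sub_halfSide_le h.sign
  have hw := h.thd.mul_one_sub_halfSide_le h.sign
  unfold sidesSize
  linarith

theorem IsTriangleSides.sidesSize_inner_le (h : IsTriangleSides σ u v w)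
    (hm : σ = 1 → sidesSize σ u v w ≤ 1) :
    sidesSize σ (midline u v w) (midline v w u) (midline w u v) ≤ sidesSize σ u v w / 2 := by
  have hm₁ : σ = 1 → sidesSize σ v w u ≤ 1 := by rwa [sidesSize_rotate]
  have hm₂ : σ = 1 → sidesSize σ w u v ≤ 1 := by rwa [← sidesSize_rotate]
  have hu := h.mul_one_sub_midline_le (h.add_nonneg_of_sidesSize_le hm)
  have hv := h.rotate.mul_one_sub_midline_le (h.rotate.add_nonneg_of_sidesSize_le hm₁)
  have hw := h.rotate.rotate.mul_one_sub_midline_le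
    (h.rotate.rotate.add_nonneg_of_sidesSize_le hm₂)
  unfold sidesSize
  linarith

end CosineLaw

section ModelForm

variable {V : Type*} [AddCommGroup V] [Module ℝ V] {B : LinearMap.BilinForm ℝ V} {σ : ℝ}
  {x y : V}

/-- A form whose unit vectors form a model of the sphere (if `σ = 1`) or of hyperbolic space (if
`σ = -1`, where the form is the negative of the Lorentz form). The tangent space of the model at `x`
is the orthogonal complement of `x`, and `σ • B` is the Riemannian metric on it. -/
structure IsModelForm (σ : ℝ) (B : LinearMap.BilinForm ℝ V) : Prop where
  sign : σ = 1 ∨ σ = -1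
  symm : B.IsSymm
  pos_of_orthogonal : ∀ x v, B x x = 1 → B x v = 0 → v ≠ 0 → 0 < σ * B v v

theorem IsModelForm.apply_comm (hB : IsModelForm σ B) (x y : V) : B x y = B y x := hB.symm.eq x y

theorem IsModelForm.eq_of_apply_eq_one (hB : IsModelForm σ B) (hx : B x x = 1) (hy : B y y = 1)
    (hxy : B x y = 1) : y = x := by
  by_contra hne
  have hpos := hB.pos_of_orthogonal x (y - x) hx (by rw [map_sub, hxy, hx, sub_self])
    (sub_ne_zero.2 hne)
  simp only [map_sub, LinearMap.sub_apply, hx, hy, hxy, hB.apply_comm y x] at hpos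
  linarith

theorem IsModelForm.mul_one_sub_sq_pos (hB : IsModelForm σ B) (hx : B x x = 1) (hy : B y y = 1)
    (hli : LinearIndependent ℝ ![x, y]) : 0 < σ * (1 - B x y ^ 2) := by
  have hv : -(B x y) • x + (1 : ℝ) • y ≠ 0 := fun h =>
    one_ne_zero (LinearIndependent.pair_iff.1 hli _ _ h).2
  have hpos := hB.pos_of_orthogonal x _ hx (by simp [hx]) hv
  simp only [map_add, map_smul, LinearMap.add_apply, LinearMap.smul_apply, smul_eq_mul, hx, hy,
    hB.apply_comm y x] at hpos
  linarith

theorem IsModelForm.mul_one_sub_apply_sq_pos (hB : IsModelForm σ B) {t : Fin 3 → V}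
    (ht : ∀ i, B (t i) (t i) = 1) (hli : LinearIndependent ℝ t) {i j : Fin 3} (hij : i ≠ j) :
    0 < σ * (1 - B (t i) (t j) ^ 2) := by
  refine hB.mul_one_sub_sq_pos (ht i) (ht j) ?_
  have hinj : Function.Injective ![i, j] := by
    simpa [Function.Injective, Fin.forall_fin_two] using ⟨hij, hij.symm⟩
  have hcomp : ![t i, t j] = t ∘ ![i, j] := by ext l; fin_cases l <;> rfl
  exact hcomp ▸ hli.comp _ hinj

theorem IsModelForm.gram_pos (hB : IsModelForm σ B) {t : Fin 3 → V} (ht : ∀ i, B (t i) (t i) = 1)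
    (hli : LinearIndependent ℝ t) : 0 < gram (B (t 1) (t 2)) (B (t 2) (t 0)) (B (t 0) (t 1)) := by
  have hsq := hB.mul_one_sub_apply_sq_pos ht hli (i := 0) (j := 1) (by decide)
  set u := B (t 1) (t 2) with hu
  set v := B (t 2) (t 0) with hv
  set w := B (t 0) (t 1) with hw
  -- `1 - w ^ 2` times the component of `t 2` orthogonal to `t 0` and `t 1`.
  set e := (u * w - v) • t 0 + (v * w - u) • t 1 + (1 - w ^ 2) • t 2 with he
  have he₀ : e ≠ 0 := fun h => by
    have h2 := Fintype.linearIndependent_iff.1 hli ![u * w - v, v * w - u, 1 - w ^ 2]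
      (by simpa [Fin.sum_univ_three] using h) 2
    simp only [Matrix.cons_val] at h2
    simp [h2] at hsq
  have horth : B (t 0) e = 0 := by
    simp only [he, map_add, map_smul, smul_eq_mul, ht, ← hw, hB.apply_comm (t 0) (t 2), ← hv]
    ring
  have hsquare : B e e = (1 - w ^ 2) * gram u v w := by
    simp only [he, map_add, map_smul, LinearMap.add_apply, LinearMap.smul_apply, smul_eq_mul, ht,
      hB.apply_comm (t 0) (t 2), hB.apply_comm (t 1) (t 0), hB.apply_comm (t 2) (t 1), ← hu, ← hv,
      ← hw, gram]
    ring
  have hpos := hB.pos_of_orthogonal (t 0) e (ht 0) horth he₀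
  rw [hsquare, ← mul_assoc] at hpos
  exact pos_of_mul_pos_right hpos hsq.le

end ModelForm

section Midpoint

variable {V : Type*} [AddCommGroup V] [Module ℝ V] {B : LinearMap.BilinForm ℝ V} {σ : ℝ}
  {x y m : V}

/-- The midpoint of two unit vectors `x` and `y` in the model of the form `B`: the vector `x + y`
rescaled to a unit vector. -/
def mid (B : LinearMap.BilinForm ℝ V) (x y : V) : V := (2 * halfSide (B x y))⁻¹ • (x + y)

theorem mid_comm (hB : B.IsSymm) (x y : V) : mid B x y = mid B y x := by
  rw [mid, mid, add_comm, ← hB.eq x y]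

theorem mid_self (hx : B x x = 1) : mid B x x = x := by
  rw [mid, hx, halfSide, add_self_div_two, sqrt_one, mul_one, ← two_smul ℝ x,
    inv_smul_smul₀ two_ne_zero]

theorem apply_mid_mid (hB : B.IsSymm) (hx : B x x = 1) (y z : V) :
    B (mid B x y) (mid B x z) = midline (B y z) (B x y) (B x z) := by
  have hyx : B y x = B x y := (hB.eq x y).symm
  simp only [mid, midline, map_smul, map_add, LinearMap.smul_apply, LinearMap.add_apply,
    smul_eq_mul, hx, hyx]
  ring

theorem apply_mid (hx : B x x = 1) (y : V) : B x (mid B x y) = halfSide (B x y) := by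
  rw [mid, map_smul, map_add, hx, smul_eq_mul, halfSide, mul_inv, mul_right_comm, ← div_eq_inv_mul,
    ← div_eq_mul_inv, div_sqrt]

theorem apply_mid_self (hB : B.IsSymm) (hx : B x x = 1) (hy : B y y = 1) (hxy : 0 < 1 + B x y) :
    B (mid B x y) (mid B x y) = 1 := by
  rw [apply_mid_mid hB hx, hy, midline, mul_assoc, halfSide, mul_self_sqrt (half_pos hxy).le]
  field_simp
  ring

theorem IsModelForm.eq_mid (hB : IsModelForm σ B) (hx : B x x = 1) (hy : B y y = 1)
    (hm : B m m = 1) (hxy : 0 < 1 + B x y) (hxm : B x m = halfSide (B x y))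
    (hmy : B m y = halfSide (B x y)) : m = mid B x y := by
  have h := halfSide_pos hxy
  refine hB.eq_of_apply_eq_one (apply_mid_self hB.symm hx hy hxy) hm ?_
  rw [mid, map_smul, map_add, LinearMap.smul_apply, LinearMap.add_apply, hB.apply_comm y m, hxm,
    hmy, smul_eq_mul, ← two_mul, inv_mul_cancel₀ (by positivity)]

end Midpoint

section ModelTriangle

variable {V : Type*} [AddCommGroup V] [Module ℝ V] {B : LinearMap.BilinForm ℝ V} {σ : ℝ}
  {t : Fin 3 → V}

/-- For a model triangle `t`, the cosine or hyperbolic cosine of the side opposite to `t i`. -/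
def sideCos (B : LinearMap.BilinForm ℝ V) (t : Fin 3 → V) (i : Fin 3) : ℝ :=
  B (t (i + 1)) (t (i + 2))

/-- The inner triangle (`none`) and the outer triangles (`some k`) of the medial subdivision in the
model of the form `B`. The vertex `k` of the outer triangle at `t k` is written `mid B (t k) (t k)`,
which is `t k`. -/
def subdiv (B : LinearMap.BilinForm ℝ V) : Option (Fin 3) → (Fin 3 → V) → Fin 3 → V
  | none, t, i => mid B (t (i + 1)) (t (i + 2))
  | some k, t, i => mid B (t k) (t i)

/-- The logarithms of the angles of a triangle in the model of the form `B`. -/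
def logAngles (σ : ℝ) (B : LinearMap.BilinForm ℝ V) (t : Fin 3 → V) (i : Fin 3) : ℝ :=
  log (cosineLawAngle σ (sideCos B t i) (sideCos B t (i + 1)) (sideCos B t (i + 2)))

/-- The size of a triangle in the model of the form `B`, see `sidesSize`. -/
def triSize (σ : ℝ) (B : LinearMap.BilinForm ℝ V) (t : Fin 3 → V) : ℝ :=
  sidesSize σ (sideCos B t 0) (sideCos B t 1) (sideCos B t 2)

/-- The vertices of a nondegenerate triangle in the model of the form `B`. -/
structure IsModelTriangle (σ : ℝ) (B : LinearMap.BilinForm ℝ V) (t : Fin 3 → V) : Prop where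
  symm : B.IsSymm
  apply_self : ∀ i, B (t i) (t i) = 1
  isTriangleSides : ∀ i,
    IsTriangleSides σ (sideCos B t i) (sideCos B t (i + 1)) (sideCos B t (i + 2))

theorem fin_three_add (i : Fin 3) :
    i + 1 + 1 = i + 2 ∧ i + 1 + 2 = i ∧ i + 2 + 1 = i ∧ i + 2 + 2 = i + 1 := by
  revert i; decide

theorem fin_three_eq_or (i j : Fin 3) : j = i ∨ j = i + 1 ∨ j = i + 2 := by
  revert i j; decide

theorem exists_subdiv_eq_mid (hB : B.IsSymm) (t : Fin 3 → V) (k : Option (Fin 3)) (i j : Fin 3) :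
    ∃ l m n, subdiv B k t i = mid B (t l) (t m) ∧ subdiv B k t j = mid B (t l) (t n) := by
  match k with
  | some k => exact ⟨k, i, j, rfl, rfl⟩
  | none =>
    simp only [subdiv]
    rcases fin_three_eq_or i j with rfl | rfl | rfl
    · exact ⟨_, _, _, rfl, rfl⟩
    · exact ⟨i + 2, i + 1, i, mid_comm hB _ _, by simp only [fin_three_add]⟩
    · exact ⟨i + 1, i + 2, i, rfl, by simp only [fin_three_add]; exact mid_comm hB _ _⟩

theorem sidesSize_sideCos (σ : ℝ) (B : LinearMap.BilinForm ℝ V) (t : Fin 3 → V) (i : Fin 3) :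
    sidesSize σ (sideCos B t i) (sideCos B t (i + 1)) (sideCos B t (i + 2)) = triSize σ B t := by
  match i with
  | 0 => rfl
  | 1 => exact sidesSize_rotate σ _ _ _
  | 2 => exact (sidesSize_rotate σ _ _ _).symm

theorem IsModelTriangle.of_isTriangleSides (hB : B.IsSymm) (ht : ∀ i, B (t i) (t i) = 1) (i : Fin 3)
    (h : IsTriangleSides σ (sideCos B t i) (sideCos B t (i + 1)) (sideCos B t (i + 2))) :
    IsModelTriangle σ B t := by
  refine ⟨hB, ht, fun j => ?_⟩
  rcases fin_three_eq_or i j with rfl | rfl | rfl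
  · exact h
  · simpa only [fin_three_add] using h.rotate
  · simpa only [fin_three_add] using h.rotate.rotate

theorem IsModelForm.isModelTriangle (hB : IsModelForm σ B) (ht : ∀ i, B (t i) (t i) = 1)
    (hli : LinearIndependent ℝ t) (hle : ∀ i j, 0 ≤ 1 + B (t i) (t j)) :
    IsModelTriangle σ B t := by
  have hside : ∀ i j, i ≠ j → IsSideCos σ (B (t i) (t j)) := fun i j hij => by
    have hsq := hB.mul_one_sub_apply_sq_pos ht hli hij
    rw [show σ * (1 - B (t i) (t j) ^ 2) =
      σ * (1 - B (t i) (t j)) * (1 + B (t i) (t j)) by ring] at hsq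
    have hpos := (hle i j).lt_of_ne' (right_ne_zero_of_mul hsq.ne')
    exact ⟨pos_of_mul_pos_left hsq hpos.le, hpos⟩
  exact .of_isTriangleSides hB.symm ht 0 ⟨hB.sign, hside 1 2 (by decide), hside 2 0 (by decide),
    hside 0 1 (by decide), hB.gram_pos ht hli⟩

theorem IsModelTriangle.one_add_apply_pos (h : IsModelTriangle σ B t) (i j : Fin 3) :
    0 < 1 + B (t i) (t j) := by
  have hside := h.isTriangleSides i
  simp only [sideCos, fin_three_add] at hside
  rcases fin_three_eq_or i j with rfl | rfl | rfl
  · linarith [h.apply_self j]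
  · exact hside.thd.one_add_pos
  · exact h.symm.eq (t i) _ ▸ hside.snd.one_add_pos

theorem IsModelTriangle.sideCos_inner (h : IsModelTriangle σ B t) (i : Fin 3) :
    sideCos B (subdiv B none t) i =
      midline (sideCos B t i) (sideCos B t (i + 1)) (sideCos B t (i + 2)) := by
  simp only [sideCos, subdiv, fin_three_add]
  rw [mid_comm h.symm (t (i + 2)), apply_mid_mid h.symm (h.apply_self i), midline_swap,
    ← h.symm.eq (t (i + 2)) (t (i + 1)), ← h.symm.eq (t (i + 2)) (t i), midline_swap]

theorem IsModelTriangle.sideCos_outer_self (h : IsModelTriangle σ B t) (k : Fin 3) :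
    sideCos B (subdiv B (some k) t) k =
      midline (sideCos B t k) (sideCos B t (k + 1)) (sideCos B t (k + 2)) := by
  simp only [sideCos, subdiv, fin_three_add]
  rw [apply_mid_mid h.symm (h.apply_self k), ← h.symm.eq (t (k + 2)) (t k), midline_swap]

theorem IsModelTriangle.sideCos_outer_add_one (h : IsModelTriangle σ B t) (k : Fin 3) :
    sideCos B (subdiv B (some k) t) (k + 1) = halfSide (sideCos B t (k + 1)) := by
  simp only [sideCos, subdiv, fin_three_add]
  rw [mid_self (h.apply_self k), ← h.symm.eq, ← h.symm.eq (t k) (t (k + 2))]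
  exact apply_mid (h.apply_self k) _

theorem IsModelTriangle.sideCos_outer_add_two (h : IsModelTriangle σ B t) (k : Fin 3) :
    sideCos B (subdiv B (some k) t) (k + 2) = halfSide (sideCos B t (k + 2)) := by
  simp only [sideCos, subdiv, fin_three_add]
  rw [mid_self (h.apply_self k)]
  exact apply_mid (h.apply_self k) _

protected theorem IsModelTriangle.subdiv (h : IsModelTriangle σ B t) (k : Option (Fin 3)) :
    IsModelTriangle σ B (subdiv B k t) := by
  have hmd : ∀ i j, B (mid B (t i) (t j)) (mid B (t i) (t j)) = 1 := fun i j =>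
    apply_mid_self h.symm (h.apply_self i) (h.apply_self j) (h.one_add_apply_pos i j)
  match k with
  | none =>
    refine .of_isTriangleSides h.symm (fun i => hmd _ _) 0 ?_
    simpa only [h.sideCos_inner, fin_three_add] using (h.isTriangleSides 0).inner
  | some k =>
    refine .of_isTriangleSides h.symm (fun i => hmd _ _) k ?_
    rw [h.sideCos_outer_self, h.sideCos_outer_add_one, h.sideCos_outer_add_two]
    exact (h.isTriangleSides k).outer

theorem IsModelTriangle.triSize_pos (h : IsModelTriangle σ B t) : 0 < triSize σ B t :=
  (h.isTriangleSides 0).sidesSize_pos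

theorem IsModelTriangle.triSize_subdiv_le (h : IsModelTriangle σ B t)
    (hm : σ = 1 → triSize σ B t ≤ 1) (k : Option (Fin 3)) :
    triSize σ B (subdiv B k t) ≤ triSize σ B t / 2 := by
  match k with
  | none =>
    rw [← sidesSize_sideCos σ _ _ 0]
    simp only [h.sideCos_inner, fin_three_add]
    exact (h.isTriangleSides 0).sidesSize_inner_le hm
  | some k =>
    rw [← sidesSize_sideCos σ _ t k] at hm ⊢
    rw [← sidesSize_sideCos σ _ _ k, h.sideCos_outer_self, h.sideCos_outer_add_one,
      h.sideCos_outer_add_two]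
    exact (h.isTriangleSides k).sidesSize_outer_le hm

theorem IsModelTriangle.dist_logAngles_subdiv_le (h : IsModelTriangle σ B t)
    (hm : triSize σ B t ≤ 1 / 8) (k : Option (Fin 3)) :
    dist (logAngles σ B t) (logAngles σ B (subdiv B k t)) ≤
      5 * triSize σ B t := by
  have hm₀ := h.triSize_pos
  refine (dist_pi_le_iff (by positivity)).2 fun i => ?_
  have hi := h.isTriangleSides i
  rw [← sidesSize_sideCos σ B t i] at hm ⊢
  rw [dist_comm, dist_eq, logAngles, logAngles]
  match k with
  | none =>
    simp only [h.sideCos_inner, fin_three_add]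
    exact hi.abs_log_cosineLawAngle_inner_sub_le hm
  | some k =>
    rcases fin_three_eq_or k i with rfl | rfl | rfl
    · rw [h.sideCos_outer_self, h.sideCos_outer_add_one, h.sideCos_outer_add_two,
        hi.cosineLawAngle_outer, sub_self, abs_zero]
      linarith [hi.sidesSize_pos]
    · simp only [fin_three_add, h.sideCos_outer_self, h.sideCos_outer_add_one,
        h.sideCos_outer_add_two] at hi hm ⊢
      exact hi.abs_log_cosineLawAngle_outer_adjacent_sub_le hm
    · have hi' := hi.swap
      rw [← sidesSize_swap] at hm ⊢
      simp only [fin_three_add, h.sideCos_outer_self, h.sideCos_outer_add_one,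
        h.sideCos_outer_add_two] at hi' hm ⊢
      rw [← cosineLawAngle_swap, ← cosineLawAngle_swap σ (sideCos B t (k + 2)), ← midline_swap]
      exact hi'.abs_log_cosineLawAngle_outer_adjacent_sub_le hm

end ModelTriangle

section SmallTriangles

variable {V : Type*} [AddCommGroup V] [Module ℝ V] {B : LinearMap.BilinForm ℝ V} {σ : ℝ}
  {t : Fin 3 → V}

/-- The triangles small enough for a subdivision step to change the logarithms of the angles by no
more than `5 * triSize`. -/
def smallTriangles (σ : ℝ) (B : LinearMap.BilinForm ℝ V) : Set (Fin 3 → V) :=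
  {t | IsModelTriangle σ B t ∧ triSize σ B t ≤ 1 / 8}

theorem subdiv_mem_smallTriangles (ht : t ∈ smallTriangles σ B) (k : Option (Fin 3)) :
    subdiv B k t ∈ smallTriangles σ B :=
  ⟨ht.1.subdiv k, by
    linarith [ht.2, ht.1.triSize_pos, ht.1.triSize_subdiv_le (fun _ => by linarith [ht.2]) k]⟩

theorem dist_logAngles_subdiv_le_sub (ht : t ∈ smallTriangles σ B) (k : Option (Fin 3)) :
    dist (logAngles σ B t) (logAngles σ B (subdiv B k t)) ≤
      10 * triSize σ B t - 10 * triSize σ B (subdiv B k t) := by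
  linarith [ht.1.dist_logAngles_subdiv_le ht.2 k,
    ht.1.triSize_subdiv_le (fun _ => by linarith [ht.2]) k]

theorem IsOrbit.mem_smallTriangles {s : ℕ → Fin 3 → V} (hs : IsOrbit (subdiv B) s)
    (h₀ : s 0 ∈ smallTriangles σ B) : ∀ n, s n ∈ smallTriangles σ B :=
  hs.mem (fun _ ht => subdiv_mem_smallTriangles ht) h₀

theorem IsOrbit.dist_logAngles_lt {s : ℕ → Fin 3 → V} (hs : IsOrbit (subdiv B) s)
    (h₀ : s 0 ∈ smallTriangles σ B) (n : ℕ) :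
    dist (logAngles σ B (s 0)) (logAngles σ B (s n)) < 10 * triSize σ B (s 0) := by
  have hle : dist (logAngles σ B (s 0)) (logAngles σ B (s n)) ≤
      10 * triSize σ B (s 0) - 10 * triSize σ B (s n) :=
    hs.dist_le (S := smallTriangles σ B) (f := logAngles σ B) (Φ := fun t => 10 * triSize σ B t)
      (fun _ ht => subdiv_mem_smallTriangles ht) (fun _ ht => dist_logAngles_subdiv_le_sub ht) h₀ n
  linarith [(hs.mem_smallTriangles h₀ n).1.triSize_pos]

theorem exists_forall_dist_logAngles_le {N : ℕ}
    (hN : ∀ s, IsOrbit (subdiv B) s → s 0 = t → s N ∈ smallTriangles σ B) :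
    ∃ K, ∀ s, IsOrbit (subdiv B) s → s 0 = t → ∀ n,
      dist (logAngles σ B t) (logAngles σ B (s n)) ≤ K :=
  exists_forall_isOrbit_dist_le (Φ := fun t => 10 * triSize σ B t) (b := 10 * (1 / 8))
    (fun _ ht => subdiv_mem_smallTriangles ht) (fun _ ht => dist_logAngles_subdiv_le_sub ht)
    (fun _ ht => by linarith [ht.1.triSize_pos]) (fun _ ht => by linarith [ht.2]) hN

theorem IsOrbit.isModelTriangle {s : ℕ → Fin 3 → V} (hs : IsOrbit (subdiv B) s)
    (h₀ : IsModelTriangle σ B (s 0)) : ∀ n, IsModelTriangle σ B (s n) :=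
  hs.mem (S := {t | IsModelTriangle σ B t}) (fun _ ht => ht.subdiv) h₀

theorem IsModelTriangle.exists_forall_isOrbit_mem_of_neg (h : IsModelTriangle (-1) B t) :
    ∃ N, ∀ s, IsOrbit (subdiv B) s → s 0 = t → s N ∈ smallTriangles (-1) B := by
  have hlim : Filter.Tendsto (fun n : ℕ => (1 / 2 : ℝ) ^ n * triSize (-1) B t) .atTop (nhds 0) := by
    simpa using (tendsto_pow_atTop_nhds_zero_of_lt_one (by norm_num : (0 : ℝ) ≤ 1 / 2)
      (by norm_num)).mul_const (triSize (-1) B t)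
  obtain ⟨N, hN⟩ := (hlim.eventually_le_const (by norm_num : (0 : ℝ) < 1 / 8)).exists
  refine ⟨N, fun s hs h₀ => ?_⟩
  subst h₀
  have hT := hs.isModelTriangle h
  refine ⟨hT N, le_trans ?_ hN⟩
  refine le_geom (u := fun n => triSize (-1) B (s n)) (by norm_num) N fun n _ => ?_
  obtain ⟨k, hk⟩ := hs n
  rw [hk]
  linarith [(hT n).triSize_subdiv_le (by norm_num) k]

end SmallTriangles

section Gnomonic

open scoped InnerProductSpace

variable {E : Type*} [NormedAddCommGroup E] [InnerProductSpace ℝ E] {c x y z : E}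
  {t : Fin 3 → E}

theorem norm_smul_sub_smul_le {E : Type*} [SeminormedAddCommGroup E] [NormedSpace ℝ E] {p q : E}
    {a b r d : ℝ} (hp : ‖p‖ ≤ d) (hq : ‖q‖ ≤ d) (hpq : ‖p - q‖ ≤ d) (ha : 0 ≤ a) (hb : 0 ≤ b)
    (har : a ≤ r) (hbr : b ≤ r) : ‖a • p - b • q‖ ≤ r * d := by
  wlog hab : a ≤ b generalizing a b p q
  · rw [norm_sub_rev]
    exact this hq hp (norm_sub_rev p q ▸ hpq) hb ha hbr har (le_of_not_ge hab)
  have hd : 0 ≤ d := (norm_nonneg p).trans hp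
  calc ‖a • p - b • q‖ = ‖a • (p - q) - (b - a) • q‖ := by congr 1; module
    _ ≤ ‖a • (p - q)‖ + ‖(b - a) • q‖ := norm_sub_le _ _
    _ = a * ‖p - q‖ + (b - a) * ‖q‖ := by
      rw [norm_smul_of_nonneg ha, norm_smul_of_nonneg (sub_nonneg.2 hab)]
    _ ≤ a * d + (b - a) * d := by gcongr
    _ = b * d := by ring
    _ ≤ r * d := by gcongr

/-- The central projection to the affine hyperplane `⟪c, x⟫ = 1`. It maps geodesics of the
hemisphere with pole `c` to straight lines. -/
def gnomonic (c x : E) : E := (⟪c, x⟫_ℝ)⁻¹ • x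

/-- The diameter of the image of a triangle under the gnomonic projection. -/
def gnomonicDiam (c : E) (t : Fin 3 → E) : ℝ := Metric.diam (Set.range fun i => gnomonic c (t i))

theorem gnomonic_smul {k : ℝ} (hk : k ≠ 0) (c x : E) : gnomonic c (k • x) = gnomonic c x := by
  rw [gnomonic, gnomonic, inner_smul_right, mul_inv_rev, mul_smul, inv_smul_smul₀ hk]

theorem gnomonic_add (hx : 0 < ⟪c, x⟫_ℝ) (hy : 0 < ⟪c, y⟫_ℝ) :
    gnomonic c (x + y) = gnomonic c x +
      (⟪c, y⟫_ℝ / (⟪c, x⟫_ℝ + ⟪c, y⟫_ℝ)) • (gnomonic c y - gnomonic c x) := by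
  simp only [gnomonic, inner_add_right]
  match_scalars <;> field_simp
  ring

theorem inner_mid (c x y : E) :
    ⟪c, mid (innerₗ E) x y⟫_ℝ = (⟪c, x⟫_ℝ + ⟪c, y⟫_ℝ) / (2 * halfSide ⟪x, y⟫_ℝ) := by
  rw [mid, inner_smul_right, inner_add_right, innerₗ_apply_apply, div_eq_inv_mul]

theorem one_le_inner_mid (hx : ‖x‖ = 1) (hy : ‖y‖ = 1) (hxy : 0 < 1 + ⟪x, y⟫_ℝ)
    (hcx : 1 ≤ ⟪c, x⟫_ℝ) (hcy : 1 ≤ ⟪c, y⟫_ℝ) : 1 ≤ ⟪c, mid (innerₗ E) x y⟫_ℝ := by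
  have hle : halfSide ⟪x, y⟫_ℝ ≤ 1 := by
    have := real_inner_le_norm x y
    rw [hx, hy] at this
    exact sqrt_le_one.2 (by linarith)
  have hpos := halfSide_pos hxy
  rw [inner_mid, le_div_iff₀ (by positivity)]
  linarith

theorem inner_div_add_le (hy : ‖y‖ = 1) (hcx : 1 ≤ ⟪c, x⟫_ℝ) (hcy : 1 ≤ ⟪c, y⟫_ℝ) :
    ⟪c, y⟫_ℝ / (⟪c, x⟫_ℝ + ⟪c, y⟫_ℝ) ≤ ‖c‖ / (1 + ‖c‖) := by
  have hle := real_inner_le_norm c y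
  rw [hy, mul_one] at hle
  rw [div_le_div_iff₀ (by linarith) (by positivity)]
  nlinarith

theorem dist_gnomonic_mid_le {d : ℝ} (hy : ‖y‖ = 1) (hz : ‖z‖ = 1)
    (hcx : 1 ≤ ⟪c, x⟫_ℝ) (hcy : 1 ≤ ⟪c, y⟫_ℝ) (hcz : 1 ≤ ⟪c, z⟫_ℝ)
    (hxy : 0 < 1 + ⟪x, y⟫_ℝ) (hxz : 0 < 1 + ⟪x, z⟫_ℝ) (hdy : dist (gnomonic c y) (gnomonic c x) ≤ d)
    (hdz : dist (gnomonic c z) (gnomonic c x) ≤ d) (hd : dist (gnomonic c y) (gnomonic c z) ≤ d) :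
    dist (gnomonic c (mid (innerₗ E) x y)) (gnomonic c (mid (innerₗ E) x z)) ≤
      ‖c‖ / (1 + ‖c‖) * d := by
  have hhy := halfSide_pos hxy
  have hhz := halfSide_pos hxz
  rw [dist_eq_norm] at hdy hdz hd ⊢
  rw [mid, mid, innerₗ_apply_apply, innerₗ_apply_apply, gnomonic_smul (by positivity),
    gnomonic_smul (by positivity), gnomonic_add (by linarith) (by linarith),
    gnomonic_add (by linarith) (by linarith), add_sub_add_left_eq_sub]
  refine norm_smul_sub_smul_le hdy hdz ?_ (by positivity) (by positivity)
    (inner_div_add_le hy hcx hcy) (inner_div_add_le hz hcx hcz)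
  rwa [sub_sub_sub_cancel_right]

theorem one_sub_inner_le (hx : ‖x‖ = 1) (hy : ‖y‖ = 1) (hcx : 0 < ⟪c, x⟫_ℝ) (hcy : 0 < ⟪c, y⟫_ℝ) :
    1 - ⟪x, y⟫_ℝ ≤ ‖c‖ ^ 2 / 2 * dist (gnomonic c x) (gnomonic c y) ^ 2 := by
  set a := ⟪c, x⟫_ℝ with ha
  set b := ⟪c, y⟫_ℝ with hb
  have hac : a ≤ ‖c‖ := by simpa only [hx, mul_one] using real_inner_le_norm c x
  have hbc : b ≤ ‖c‖ := by simpa only [hy, mul_one] using real_inner_le_norm c y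
  have hdist : a * b * dist (gnomonic c x) (gnomonic c y) ^ 2 =
      2 - 2 * ⟪x, y⟫_ℝ + (a - b) ^ 2 / (a * b) := by
    rw [dist_eq_norm, norm_sub_sq_real, gnomonic, gnomonic, norm_smul, norm_smul, hx, hy, ← ha,
      ← hb, real_inner_smul_left, real_inner_smul_right, mul_one, mul_one, norm_eq_abs, norm_eq_abs,
      sq_abs, sq_abs]
    field_simp
    ring
  calc 1 - ⟪x, y⟫_ℝ ≤ a * b * dist (gnomonic c x) (gnomonic c y) ^ 2 / 2 := by
        rw [hdist]
        have : 0 ≤ (a - b) ^ 2 / (a * b) := by positivity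
        linarith
    _ ≤ ‖c‖ * ‖c‖ * dist (gnomonic c x) (gnomonic c y) ^ 2 / 2 := by gcongr
    _ = ‖c‖ ^ 2 / 2 * dist (gnomonic c x) (gnomonic c y) ^ 2 := by ring

/-- The spherical triangles whose vertices have height at least `1` over the hyperplane orthogonal
to `c`. -/
def highTriangles (c : E) : Set (Fin 3 → E) :=
  {t | IsModelTriangle 1 (innerₗ E) t ∧ ∀ i, 1 ≤ ⟪c, t i⟫_ℝ}

theorem IsModelTriangle.norm_eq_one {σ : ℝ} (h : IsModelTriangle σ (innerₗ E) t) (i : Fin 3) :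
    ‖t i‖ = 1 := by
  have hi := h.apply_self i
  rwa [innerₗ_apply_apply, real_inner_self_eq_norm_sq,
    pow_eq_one_iff_of_nonneg (norm_nonneg _) two_ne_zero] at hi

theorem subdiv_mem_highTriangles (ht : t ∈ highTriangles c) (k : Option (Fin 3)) :
    subdiv (innerₗ E) k t ∈ highTriangles c := by
  refine ⟨ht.1.subdiv k, fun i => ?_⟩
  obtain ⟨l, m, -, hi, -⟩ := exists_subdiv_eq_mid ht.1.symm t k i i
  rw [hi]
  exact one_le_inner_mid (ht.1.norm_eq_one l) (ht.1.norm_eq_one m) (ht.1.one_add_apply_pos l m)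
    (ht.2 l) (ht.2 m)

theorem dist_gnomonic_le (c : E) (t : Fin 3 → E) (i j : Fin 3) :
    dist (gnomonic c (t i)) (gnomonic c (t j)) ≤ gnomonicDiam c t :=
  Metric.dist_le_diam_of_mem (Set.finite_range _).isBounded ⟨i, rfl⟩ ⟨j, rfl⟩

theorem gnomonicDiam_subdiv_le (ht : t ∈ highTriangles c) (k : Option (Fin 3)) :
    gnomonicDiam c (subdiv (innerₗ E) k t) ≤ ‖c‖ / (1 + ‖c‖) * gnomonicDiam c t := by
  have hnn : 0 ≤ gnomonicDiam c t := Metric.diam_nonneg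
  refine Metric.diam_le_of_forall_dist_le (by positivity) ?_
  rintro _ ⟨i, rfl⟩ _ ⟨j, rfl⟩
  obtain ⟨l, m, n, hi, hj⟩ := exists_subdiv_eq_mid ht.1.symm t k i j
  simp only [hi, hj]
  exact dist_gnomonic_mid_le (ht.1.norm_eq_one m) (ht.1.norm_eq_one n) (ht.2 l) (ht.2 m) (ht.2 n)
    (ht.1.one_add_apply_pos l m) (ht.1.one_add_apply_pos l n) (dist_gnomonic_le c t m l)
    (dist_gnomonic_le c t n l) (dist_gnomonic_le c t m n)

theorem triSize_le_gnomonicDiam_sq (ht : t ∈ highTriangles c) :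
    triSize 1 (innerₗ E) t ≤ 3 / 2 * (‖c‖ * gnomonicDiam c t) ^ 2 := by
  have hside : ∀ i, 1 - sideCos (innerₗ E) t i ≤ (‖c‖ * gnomonicDiam c t) ^ 2 / 2 := fun i => by
    calc 1 - sideCos (innerₗ E) t i
        ≤ ‖c‖ ^ 2 / 2 * dist (gnomonic c (t (i + 1))) (gnomonic c (t (i + 2))) ^ 2 :=
          one_sub_inner_le (ht.1.norm_eq_one _) (ht.1.norm_eq_one _)
            (zero_lt_one.trans_le (ht.2 _)) (zero_lt_one.trans_le (ht.2 _))
      _ ≤ ‖c‖ ^ 2 / 2 * gnomonicDiam c t ^ 2 := by gcongr; exact dist_gnomonic_le c t _ _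
      _ = (‖c‖ * gnomonicDiam c t) ^ 2 / 2 := by ring
  rw [triSize, sidesSize]
  linarith [hside 0, hside 1, hside 2]

theorem exists_forall_isOrbit_mem_of_mem_highTriangles (ht : t ∈ highTriangles c) :
    ∃ N, ∀ s, IsOrbit (subdiv (innerₗ E)) s → s 0 = t → s N ∈ smallTriangles 1 (innerₗ E) := by
  set ρ := ‖c‖ / (1 + ‖c‖)
  have hρ₀ : 0 ≤ ρ := by positivity
  have hρ₁ : ρ < 1 := (div_lt_one (by positivity)).2 (by linarith)
  have hlim : Filter.Tendsto (fun n : ℕ => ‖c‖ * (ρ ^ n * gnomonicDiam c t)) .atTop (nhds 0) := by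
    simpa only [zero_mul, mul_zero] using
      ((tendsto_pow_atTop_nhds_zero_of_lt_one hρ₀ hρ₁).mul_const (gnomonicDiam c t)).const_mul ‖c‖
  obtain ⟨N, hN⟩ := (hlim.eventually_le_const (by norm_num : (0 : ℝ) < 1 / 4)).exists
  refine ⟨N, fun s hs h₀ => ?_⟩
  subst h₀
  have hhigh : ∀ n, s n ∈ highTriangles c := hs.mem (fun _ h => subdiv_mem_highTriangles h) ht
  have hdiam : gnomonicDiam c (s N) ≤ ρ ^ N * gnomonicDiam c (s 0) :=
    le_geom (u := fun n => gnomonicDiam c (s n)) hρ₀ N fun n _ => by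
      obtain ⟨k, hk⟩ := hs n
      rw [hk]
      exact gnomonicDiam_subdiv_le (hhigh n) k
  have hnn : 0 ≤ gnomonicDiam c (s N) := Metric.diam_nonneg
  refine ⟨(hhigh N).1, (triSize_le_gnomonicDiam_sq (hhigh N)).trans ?_⟩
  have hsmall : ‖c‖ * gnomonicDiam c (s N) ≤ 1 / 4 := le_trans (by gcongr) hN
  calc 3 / 2 * (‖c‖ * gnomonicDiam c (s N)) ^ 2 ≤ 3 / 2 * (1 / 4) ^ 2 := by gcongr
    _ ≤ 1 / 8 := by norm_num

theorem IsModelTriangle.exists_forall_isOrbit_mem_of_pos (h : IsModelTriangle 1 (innerₗ E) t)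
    (hc : ∃ c, ∀ i, 0 < ⟪c, t i⟫_ℝ) :
    ∃ N, ∀ s, IsOrbit (subdiv (innerₗ E)) s → s 0 = t → s N ∈ smallTriangles 1 (innerₗ E) := by
  obtain ⟨c, hc⟩ := hc
  obtain ⟨j, hj⟩ := Finite.exists_min fun i => ⟪c, t i⟫_ℝ
  refine exists_forall_isOrbit_mem_of_mem_highTriangles (c := (⟪c, t j⟫_ℝ)⁻¹ • c) ⟨h, fun i => ?_⟩
  rw [real_inner_smul_left, ← div_eq_inv_mul, one_le_div (hc j)]
  exact hj i

end Gnomonic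

section AngleControl

open Filter Topology

/-- The logarithms of the angles of a triangle. -/
def PlaneGeometry.logAngles (G : PlaneGeometry) (t : Fin 3 → G.Point) (i : Fin 3) : ℝ :=
  log (G.vertexAngle t i)

/-- The angles of the triangles nested in a triangle `t₀` of the geometry `G` differ from those of
`t₀` by factors between `exp (-K t₀)` and `exp (K t₀)`, and `K t₀` tends to `0` with the sides of
`t₀`. -/
structure HasAngleControl (G : PlaneGeometry) (K : (Fin 3 → G.Point) → ℝ) : Prop where
  pos : ∀ t₀, G.IsTriangle t₀ → 0 < K t₀
  vertexAngle_pos : ∀ t, G.IsNested t → ∀ n i, 0 < G.vertexAngle (t n) i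
  dist_logAngles_lt : ∀ t, G.IsNested t → ∀ n,
    dist (G.logAngles (t 0)) (G.logAngles (t n)) < K (t 0)
  lt_of_dist_lt : ∀ ε > 0, ∃ δ > 0, ∀ t₀, G.IsTriangle t₀ → (∀ i j, G.dist (t₀ i) (t₀ j) < δ) →
    K t₀ < ε

variable {G : PlaneGeometry} {V : Type*} [AddCommGroup V] [Module ℝ V]
  {B : LinearMap.BilinForm ℝ V} {σ : ℝ} {emb : G.Point → V} {cs : ℝ → ℝ}

/-- The map `emb` identifies the points of `G` with unit vectors of the form `B`. The function `cs`
is `cos` or `cosh`, composed with a rescaling, and `B` computes the lengths of segments through it.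
The last field says that deep enough subdivisions of a triangle are small. -/
structure IsModel (G : PlaneGeometry) (σ : ℝ) (B : LinearMap.BilinForm ℝ V) (emb : G.Point → V)
    (cs : ℝ → ℝ) : Prop where
  isModelForm : IsModelForm σ B
  apply_self : ∀ p, B (emb p) (emb p) = 1
  tendsto_cs : Tendsto cs (𝓝 0) (𝓝 1)
  dist_nonneg : ∀ p q, 0 ≤ G.dist p q
  cs_dist : ∀ p q, cs (G.dist p q) = B (emb p) (emb q)
  cs_half_dist : ∀ p q, cs (G.dist p q / 2) = halfSide (B (emb p) (emb q))
  angle_eq : ∀ p q r, G.angle q p r =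
    cosineLawAngle σ (B (emb q) (emb r)) (B (emb r) (emb p)) (B (emb p) (emb q))
  isModelTriangle : ∀ t, G.IsTriangle t → IsModelTriangle σ B fun i => emb (t i)
  exists_forall_isOrbit_mem : ∀ t, G.IsTriangle t → ∃ N, ∀ s, IsOrbit (subdiv B) s →
    (s 0 = fun i => emb (t i)) → s N ∈ smallTriangles σ B

theorem IsModel.rescale (h : IsModel G σ B emb cs) {c : ℝ} (hc : 0 < c) :
    IsModel (G.rescale c) σ B emb fun d => cs (d / c) where
  isModelForm := h.isModelForm
  apply_self := h.apply_self
  tendsto_cs := h.tendsto_cs.comp <| by simpa using (tendsto_id (x := 𝓝 (0 : ℝ))).div_const c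
  dist_nonneg p q := mul_nonneg hc.le (h.dist_nonneg p q)
  cs_dist p q := (congr_arg cs (mul_div_cancel_left₀ _ hc.ne')).trans (h.cs_dist p q)
  cs_half_dist p q := by
    rw [div_right_comm]
    exact (congr_arg (fun d => cs (d / 2)) (mul_div_cancel_left₀ _ hc.ne')).trans
      (h.cs_half_dist p q)
  angle_eq := h.angle_eq
  isModelTriangle := h.isModelTriangle
  exists_forall_isOrbit_mem := h.exists_forall_isOrbit_mem

theorem IsModel.emb_eq_mid (h : IsModel G σ B emb cs) {m p q : G.Point} (hm : G.IsMidpoint m p q)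
    (hpq : 0 < 1 + B (emb p) (emb q)) : emb m = mid B (emb p) (emb q) :=
  h.isModelForm.eq_mid (h.apply_self p) (h.apply_self q) (h.apply_self m) hpq
    (by rw [← h.cs_dist, hm.1, h.cs_half_dist]) (by rw [← h.cs_dist, hm.2, h.cs_half_dist])

theorem IsModel.logAngles_eq (h : IsModel G σ B emb cs) (t : Fin 3 → G.Point) :
    G.logAngles t = logAngles σ B fun i => emb (t i) := by
  funext i
  simp only [PlaneGeometry.logAngles, PlaneGeometry.vertexAngle, h.angle_eq, logAngles, sideCos,
    fin_three_add]

theorem IsModel.vertexAngle_pos (h : IsModel G σ B emb cs) {t : Fin 3 → G.Point}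
    (ht : IsModelTriangle σ B fun i => emb (t i)) (i : Fin 3) : 0 < G.vertexAngle t i := by
  have hpos := (ht.isTriangleSides i).cosineLawAngle_pos
  simp only [sideCos, fin_three_add] at hpos
  rwa [PlaneGeometry.vertexAngle, h.angle_eq]

theorem IsModel.exists_eq_subdiv (h : IsModel G σ B emb cs) {t t' : Fin 3 → G.Point}
    (ht : IsModelTriangle σ B fun i => emb (t i))
    (hstep : G.IsInner t t' ∨ ∃ k, G.IsOuter k t t') :
    ∃ k, (fun i => emb (t' i)) = subdiv B k fun i => emb (t i) := by
  rcases hstep with hin | ⟨k, hk, hout⟩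
  · exact ⟨none, funext fun i => h.emb_eq_mid (hin i) (ht.one_add_apply_pos _ _)⟩
  · refine ⟨some k, funext fun i => ?_⟩
    by_cases hi : i = k
    · rw [hi, hk]
      exact (mid_self (h.apply_self _)).symm
    · exact h.emb_eq_mid (hout i hi) (ht.one_add_apply_pos k i)

theorem IsModel.isModelTriangle_of_isNested (h : IsModel G σ B emb cs) {t : ℕ → Fin 3 → G.Point}
    (ht : G.IsNested t) : ∀ n, IsModelTriangle σ B fun i => emb (t n i)
  | 0 => h.isModelTriangle _ ht.1
  | n + 1 => by
    have hn := h.isModelTriangle_of_isNested ht n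
    obtain ⟨k, hk⟩ := h.exists_eq_subdiv hn (ht.2 n)
    rw [hk]
    exact hn.subdiv k

theorem IsModel.isOrbit (h : IsModel G σ B emb cs) {t : ℕ → Fin 3 → G.Point} (ht : G.IsNested t) :
    IsOrbit (subdiv B) fun n i => emb (t n i) :=
  fun n => h.exists_eq_subdiv (h.isModelTriangle_of_isNested ht n) (ht.2 n)

theorem IsModel.exists_forall_triSize_lt (h : IsModel G σ B emb cs) {ε : ℝ} (hε : 0 < ε) :
    ∃ δ > 0, ∀ t : Fin 3 → G.Point, (∀ i j, G.dist (t i) (t j) < δ) →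
      triSize σ B (fun i => emb (t i)) < ε := by
  obtain ⟨δ, hδ, hcs⟩ := Metric.tendsto_nhds_nhds.1 h.tendsto_cs (ε / 3) (by positivity)
  refine ⟨δ, hδ, fun t ht => ?_⟩
  have hside : ∀ i, σ * (1 - sideCos B (fun i => emb (t i)) i) < ε / 3 := fun i => by
    have hd := hcs (x := G.dist (t (i + 1)) (t (i + 2))) (by
      rw [dist_zero_right, norm_of_nonneg (h.dist_nonneg _ _)]
      exact ht _ _)
    rw [h.cs_dist, dist_eq] at hd
    obtain ⟨hl, hr⟩ := abs_lt.1 hd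
    unfold sideCos
    rcases h.isModelForm.sign with rfl | rfl <;> linarith
  rw [triSize, sidesSize]
  linarith [hside 0, hside 1, hside 2]

theorem IsModel.exists_pos_forall_dist_lt (h : IsModel G σ B emb cs) (t : Fin 3 → G.Point)
    (ht : G.IsTriangle t) :
    ∃ K > 0, (∀ s, IsOrbit (subdiv B) s → (s 0 = fun i => emb (t i)) → ∀ n,
      dist (logAngles σ B (s 0)) (logAngles σ B (s n)) < K) ∧
      (triSize σ B (fun i => emb (t i)) ≤ 1 / 8 → K ≤ 10 * triSize σ B fun i => emb (t i)) := by
  have hT := h.isModelTriangle t ht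
  by_cases hsmall : triSize σ B (fun i => emb (t i)) ≤ 1 / 8
  · refine ⟨_, mul_pos (by norm_num) hT.triSize_pos, fun s hs h₀ n => ?_, fun _ => le_rfl⟩
    rw [← h₀]
    exact hs.dist_logAngles_lt (h₀ ▸ ⟨hT, hsmall⟩) n
  · obtain ⟨N, hN⟩ := h.exists_forall_isOrbit_mem t ht
    obtain ⟨K, hK⟩ := exists_forall_dist_logAngles_le hN
    refine ⟨|K| + 1, by positivity, fun s hs h₀ n => ?_, fun hle => absurd hle hsmall⟩
    rw [h₀]
    linarith [hK s hs h₀ n, le_abs_self K]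

theorem IsModel.exists_hasAngleControl (h : IsModel G σ B emb cs) :
    ∃ K, HasAngleControl G K := by
  choose! K hpos hK hle using h.exists_pos_forall_dist_lt
  refine ⟨K, hpos, fun t ht n => h.vertexAngle_pos (h.isModelTriangle_of_isNested ht n),
    fun t ht n => ?_, fun ε hε => ?_⟩
  · rw [h.logAngles_eq, h.logAngles_eq]
    exact hK (t 0) ht.1 _ (h.isOrbit ht) rfl n
  · obtain ⟨δ, hδ, hsize⟩ := h.exists_forall_triSize_lt (lt_min (show (0 : ℝ) < 1 / 8 by norm_num)
      (show 0 < ε / 10 by positivity))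
    refine ⟨δ, hδ, fun t ht hdist => ?_⟩
    obtain ⟨hm, hm'⟩ := lt_min_iff.1 (hsize t hdist)
    linarith [hle t ht hm.le]

theorem HasAngleControl.mul_exp_lt {K : (Fin 3 → G.Point) → ℝ} (h : HasAngleControl G K)
    {t : ℕ → Fin 3 → G.Point} (ht : G.IsNested t) (i : Fin 3) (n : ℕ) :
    G.vertexAngle (t 0) i * exp (-K (t 0)) < G.vertexAngle (t n) i ∧
      G.vertexAngle (t n) i < G.vertexAngle (t 0) i * exp (K (t 0)) := by
  have h₀ := h.vertexAngle_pos t ht 0 i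
  have hn := h.vertexAngle_pos t ht n i
  have hdist := (dist_le_pi_dist _ _ i).trans_lt (h.dist_logAngles_lt t ht n)
  rw [PlaneGeometry.logAngles, PlaneGeometry.logAngles, dist_eq, abs_sub_lt_iff] at hdist
  constructor
  · rw [← log_lt_log_iff (by positivity) hn, log_mul h₀.ne' (exp_ne_zero _), log_exp]
    linarith
  · rw [← log_lt_log_iff hn (by positivity), log_mul h₀.ne' (exp_ne_zero _), log_exp]
    linarith

theorem one_sub_lt_exp_neg {x ε : ℝ} (hx : exp x < 1 + ε) : 1 - ε < exp (-x) := by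
  linarith [add_one_le_exp x, add_one_le_exp (-x)]

end AngleControl

section HyperbolicPlane

/-- The negative of the Lorentz form, which takes the value `1` on the hyperboloid. -/
def hyperbolicForm : LinearMap.BilinForm ℝ (Fin 3 → ℝ) :=
  LinearMap.mk₂ ℝ (fun x y => -lorentz x y)
    (fun _ _ _ => by simp only [lorentz, Pi.add_apply]; ring)
    (fun _ _ _ => by simp only [lorentz, Pi.smul_apply, smul_eq_mul]; ring)
    (fun _ _ _ => by simp only [lorentz, Pi.add_apply]; ring)
    (fun _ _ _ => by simp only [lorentz, Pi.smul_apply, smul_eq_mul]; ring)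

theorem hyperbolicForm_apply (x y : Fin 3 → ℝ) : hyperbolicForm x y = -lorentz x y :=
  LinearMap.mk₂_apply ..

theorem lorentz_self_pos_of_orthogonal {x v : Fin 3 → ℝ} (hx : lorentz x x = -1)
    (hxv : lorentz x v = 0) (hv : v ≠ 0) : 0 < lorentz v v := by
  have hx₂ : 0 < x 2 ^ 2 := by
    unfold lorentz at hx
    nlinarith [sq_nonneg (x 0), sq_nonneg (x 1)]
  have hmul : x 2 ^ 2 * lorentz v v = v 0 ^ 2 + v 1 ^ 2 + (x 0 * v 1 - x 1 * v 0) ^ 2 := by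
    unfold lorentz at hx hxv ⊢
    linear_combination (x 0 * v 0 + x 1 * v 1 + x 2 * v 2) * hxv - (v 0 ^ 2 + v 1 ^ 2) * hx
  refine pos_of_mul_pos_right (hmul ▸ lt_of_le_of_ne (by positivity) fun h => hv ?_) hx₂.le
  have hv₀ : v 0 = 0 := by nlinarith [sq_nonneg (v 1), sq_nonneg (x 0 * v 1 - x 1 * v 0)]
  have hv₁ : v 1 = 0 := by nlinarith [sq_nonneg (v 0), sq_nonneg (x 0 * v 1 - x 1 * v 0)]
  have hv₂ : v 2 = 0 := by
    simpa [lorentz, hv₀, hv₁, pow_pos_iff, (sq_pos_iff.1 hx₂)] using hxv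
  ext i
  fin_cases i <;> assumption

theorem isModelForm_hyperbolicForm : IsModelForm (-1) hyperbolicForm where
  sign := .inr rfl
  symm := ⟨fun x y => by simp only [hyperbolicForm_apply, lorentz]; ring⟩
  pos_of_orthogonal x v hx hxv hv := by
    rw [hyperbolicForm_apply] at *
    linarith [lorentz_self_pos_of_orthogonal (neg_eq_iff_eq_neg.1 hx) (neg_eq_zero.1 hxv) hv]

theorem hyperbolicForm_self (p : Hyperboloid) : hyperbolicForm p.1 p.1 = 1 := by
  rw [hyperbolicForm_apply, p.2.1, neg_neg]

theorem one_le_hyperbolicForm (p q : Hyperboloid) : 1 ≤ hyperbolicForm p.1 q.1 := by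
  obtain ⟨x, hx, hx₂⟩ := p
  obtain ⟨y, hy, hy₂⟩ := q
  rw [hyperbolicForm_apply]
  unfold lorentz at *
  have hsq : (1 + (x 0 * y 0 + x 1 * y 1)) ^ 2 ≤ (x 2 * y 2) ^ 2 := by
    have hprod : (x 2 * y 2) ^ 2 = (1 + x 0 ^ 2 + x 1 ^ 2) * (1 + y 0 ^ 2 + y 1 ^ 2) := by
      linear_combination -(y 2 ^ 2) * hx - (1 + x 0 ^ 2 + x 1 ^ 2) * hy
    rw [hprod]
    nlinarith [sq_nonneg (x 0 - y 0), sq_nonneg (x 1 - y 1), sq_nonneg (x 0 * y 1 - x 1 * y 0)]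
  linarith [abs_le_of_sq_le_sq hsq (by positivity), le_abs_self (1 + (x 0 * y 0 + x 1 * y 1))]

theorem dist_hyperbolicPlane (p q : Hyperboloid) :
    hyperbolicPlane.dist p q = arcosh (hyperbolicForm p.1 q.1) := by
  rw [hyperbolicForm_apply]
  rfl

theorem cosh_half_arcosh {w : ℝ} (hw : 1 ≤ w) : cosh (arcosh w / 2) = halfSide w := by
  have hdouble := cosh_two_mul (arcosh w / 2)
  rw [mul_div_cancel₀ _ two_ne_zero, cosh_arcosh hw, sinh_sq] at hdouble
  rw [← halfSide_two_mul_sq_sub_one (cosh_pos (arcosh w / 2)).le]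
  exact congr_arg halfSide (by linarith)

theorem dist_hyperbolicPlane_nonneg (p q : Hyperboloid) : 0 ≤ hyperbolicPlane.dist p q := by
  rw [dist_hyperbolicPlane]
  exact arcosh_nonneg (one_le_hyperbolicForm p q)

theorem cosh_dist_hyperbolicPlane (p q : Hyperboloid) :
    cosh (hyperbolicPlane.dist p q) = hyperbolicForm p.1 q.1 := by
  rw [dist_hyperbolicPlane, cosh_arcosh (one_le_hyperbolicForm p q)]

theorem cosh_half_dist_hyperbolicPlane (p q : Hyperboloid) :
    cosh (hyperbolicPlane.dist p q / 2) = halfSide (hyperbolicForm p.1 q.1) := by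
  rw [dist_hyperbolicPlane, cosh_half_arcosh (one_le_hyperbolicForm p q)]

theorem lorentz_hypDir (p q r : Hyperboloid) : lorentz (hypDir p q) (hypDir p r) =
    lorentz q.1 r.1 + lorentz p.1 q.1 * lorentz p.1 r.1 := by
  have hp := p.2.1
  simp only [hypDir, lorentz, Pi.add_apply, Pi.smul_apply, smul_eq_mul] at *
  linear_combination (p.1 0 * q.1 0 + p.1 1 * q.1 1 - p.1 2 * q.1 2) *
    (p.1 0 * r.1 0 + p.1 1 * r.1 1 - p.1 2 * r.1 2) * hp

theorem angle_hyperbolicPlane (p q r : Hyperboloid) : hyperbolicPlane.angle q p r =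
    cosineLawAngle (-1) (hyperbolicForm q.1 r.1) (hyperbolicForm r.1 p.1)
      (hyperbolicForm p.1 q.1) := by
  rw [cosineLawAngle_swap, isModelForm_hyperbolicForm.apply_comm r.1, cosineLawAngle]
  simp only [hyperbolicForm_apply, hyperbolicPlane, lorentz_hypDir, q.2.1, r.2.1]
  congr 3 <;> ring_nf

theorem isModel_hyperbolicPlane :
    IsModel hyperbolicPlane (-1) hyperbolicForm (Subtype.val : Hyperboloid → Fin 3 → ℝ) cosh :=
  have hT : ∀ t, hyperbolicPlane.IsTriangle t →
      IsModelTriangle (-1) hyperbolicForm fun i => (t i).1 := fun t ht =>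
    isModelForm_hyperbolicForm.isModelTriangle (fun i => hyperbolicForm_self _) ht fun i j => by
      linarith [one_le_hyperbolicForm (t i) (t j)]
  { isModelForm := isModelForm_hyperbolicForm
    apply_self := hyperbolicForm_self
    tendsto_cs := by simpa using continuous_cosh.tendsto 0
    dist_nonneg := dist_hyperbolicPlane_nonneg
    cs_dist := cosh_dist_hyperbolicPlane
    cs_half_dist := cosh_half_dist_hyperbolicPlane
    angle_eq := angle_hyperbolicPlane
    isModelTriangle := hT
    exists_forall_isOrbit_mem := fun t ht => (hT t ht).exists_forall_isOrbit_mem_of_neg }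

end HyperbolicPlane

section Sphere

open scoped InnerProductSpace

theorem isModelForm_innerₗ (E : Type*) [NormedAddCommGroup E] [InnerProductSpace ℝ E] :
    IsModelForm 1 (innerₗ E) where
  sign := .inl rfl
  symm := ⟨fun x y => real_inner_comm y x⟩
  pos_of_orthogonal _ _ _ _ hv := by
    rw [one_mul, innerₗ_apply_apply]
    exact real_inner_self_pos.2 hv

theorem inner_self_sphere (p : Sphere2) : ⟪p.1, p.1⟫_ℝ = 1 := by
  rw [real_inner_self_eq_norm_sq, mem_sphere_zero_iff_norm.1 p.2, one_pow]

theorem abs_inner_sphere_le (p q : Sphere2) : |⟪p.1, q.1⟫_ℝ| ≤ 1 := by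
  simpa only [mem_sphere_zero_iff_norm.1 p.2, mem_sphere_zero_iff_norm.1 q.2, one_mul] using
    abs_real_inner_le_norm p.1 q.1

theorem dist_unitSphere (p q : Sphere2) : unitSphere.dist p q = arccos ⟪p.1, q.1⟫_ℝ := by
  change arccos _ = _
  rw [mem_sphere_zero_iff_norm.1 p.2, mem_sphere_zero_iff_norm.1 q.2, one_mul, div_one]

theorem cos_dist_unitSphere (p q : Sphere2) : cos (unitSphere.dist p q) = ⟪p.1, q.1⟫_ℝ := by
  obtain ⟨hl, hr⟩ := abs_le.1 (abs_inner_sphere_le p q)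
  rw [dist_unitSphere, cos_arccos hl hr]

theorem cos_half_dist_unitSphere (p q : Sphere2) :
    cos (unitSphere.dist p q / 2) = halfSide ⟪p.1, q.1⟫_ℝ := by
  have hπ : unitSphere.dist p q ≤ π := InnerProductGeometry.angle_le_pi _ _
  have hnn : 0 ≤ unitSphere.dist p q := InnerProductGeometry.angle_nonneg _ _
  rw [cos_half (by linarith [pi_pos]) hπ, cos_dist_unitSphere, halfSide]

theorem inner_sphDir (p q r : Sphere2) :
    ⟪sphDir p q, sphDir p r⟫_ℝ = ⟪q.1, r.1⟫_ℝ - ⟪p.1, q.1⟫_ℝ * ⟪p.1, r.1⟫_ℝ := by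
  simp only [sphDir, inner_sub_left, inner_sub_right, real_inner_smul_left, real_inner_smul_right,
    inner_self_sphere, real_inner_comm p.1 q.1]
  ring

theorem angle_unitSphere (p q r : Sphere2) : unitSphere.angle q p r =
    cosineLawAngle 1 ⟪q.1, r.1⟫_ℝ ⟪r.1, p.1⟫_ℝ ⟪p.1, q.1⟫_ℝ := by
  rw [cosineLawAngle_swap, real_inner_comm p.1 r.1, cosineLawAngle]
  simp only [unitSphere, InnerProductGeometry.angle, norm_eq_sqrt_real_inner, inner_sphDir,
    inner_self_sphere]
  congr 3 <;> ring_nf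

theorem isModel_unitSphere :
    IsModel unitSphere 1 (innerₗ (EuclideanSpace ℝ (Fin 3))) (fun p : Sphere2 => p.1) cos :=
  have hT : ∀ t, unitSphere.IsTriangle t →
      IsModelTriangle 1 (innerₗ (EuclideanSpace ℝ (Fin 3))) fun i => (t i).1 := fun t ht =>
    (isModelForm_innerₗ _).isModelTriangle (fun i => inner_self_sphere _) ht.1 fun i j => by
      rw [innerₗ_apply_apply]
      linarith [(abs_le.1 (abs_inner_sphere_le (t i) (t j))).1]
  { isModelForm := isModelForm_innerₗ _
    apply_self := inner_self_sphere
    tendsto_cs := by simpa using continuous_cos.tendsto 0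
    dist_nonneg := fun p q => InnerProductGeometry.angle_nonneg _ _
    cs_dist := cos_dist_unitSphere
    cs_half_dist := cos_half_dist_unitSphere
    angle_eq := angle_unitSphere
    isModelTriangle := hT
    exists_forall_isOrbit_mem := fun t ht => (hT t ht).exists_forall_isOrbit_mem_of_pos ht.2 }

end Sphere

section EuclideanPlane

open EuclideanGeometry

theorem angle_eq_of_sub_eq_smul {E : Type*} [NormedAddCommGroup E] [InnerProductSpace ℝ E]
    {p q r p' q' r' : E} {c : ℝ} (hc : c ≠ 0) (hq : q' - p' = c • (q - p))
    (hr : r' - p' = c • (r - p)) : ∠ q' p' r' = ∠ q p r := by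
  rw [angle, angle, vsub_eq_sub, vsub_eq_sub, vsub_eq_sub, vsub_eq_sub, hq, hr,
    InnerProductGeometry.angle_smul_smul hc]

variable {t t' : Fin 3 → EuclideanSpace ℝ (Fin 2)}

theorem eq_of_isMidpoint {m p q : EuclideanSpace ℝ (Fin 2)} (h : euclideanPlane.IsMidpoint m p q) :
    m = (1 / 2 : ℝ) • (p + q) := by
  rw [eq_midpoint_of_dist_eq_half h.1 h.2, midpoint_eq_smul_add, invOf_eq_inv, one_div]

theorem vertexAngle_eq_of_isInner (h : euclideanPlane.IsInner t t') (i : Fin 3) :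
    euclideanPlane.vertexAngle t' i = euclideanPlane.vertexAngle t i := by
  have hmid := fun i => eq_of_isMidpoint (h i)
  refine angle_eq_of_sub_eq_smul (c := -(1 / 2)) (by norm_num) ?_ ?_
  all_goals
    simp only [hmid, fin_three_add]
    module

theorem vertexAngle_eq_of_isOuter {k : Fin 3} (h : euclideanPlane.IsOuter k t t') (i : Fin 3) :
    euclideanPlane.vertexAngle t' i = euclideanPlane.vertexAngle t i := by
  have hmid : ∀ i, t' i = (1 / 2 : ℝ) • (t k + t i) := by
    intro i
    by_cases hi : i = k
    · rw [hi, h.1]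
      module
    · exact eq_of_isMidpoint (h.2 i hi)
  refine angle_eq_of_sub_eq_smul (c := 1 / 2) (by norm_num) ?_ ?_
  all_goals
    simp only [hmid]
    module

theorem vertexAngle_eq_of_isNested {t : ℕ → Fin 3 → EuclideanSpace ℝ (Fin 2)}
    (h : euclideanPlane.IsNested t) (n : ℕ) :
    euclideanPlane.vertexAngle (t n) = euclideanPlane.vertexAngle (t 0) := by
  induction n with
  | zero => rfl
  | succ n ih =>
    rw [← ih]
    rcases h.2 n with hin | ⟨k, hout⟩
    · exact funext (vertexAngle_eq_of_isInner hin)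
    · exact funext (vertexAngle_eq_of_isOuter hout)

theorem vertexAngle_euclideanPlane_pos (h : AffineIndependent ℝ t) (i : Fin 3) :
    0 < euclideanPlane.vertexAngle t i := by
  refine (angle_nonneg _ _ _).lt_of_ne' fun h₀ => affineIndependent_iff_not_collinear.1 h ?_
  refine (collinear_of_angle_eq_zero h₀).subset ?_
  rintro _ ⟨j, rfl⟩
  rcases fin_three_eq_or i j with rfl | rfl | rfl <;> simp

theorem hasAngleControl_euclideanPlane :
    HasAngleControl euclideanPlane fun t => euclideanPlane.dist (t 0) (t 1) :=
  have hdist : ∀ t, euclideanPlane.IsTriangle t → 0 < euclideanPlane.dist (t 0) (t 1) :=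
    fun _ ht => dist_pos.2 (AffineIndependent.injective ht |>.ne (by decide))
  { pos := hdist
    vertexAngle_pos := fun t ht n i => by
      rw [vertexAngle_eq_of_isNested ht n]
      exact vertexAngle_euclideanPlane_pos ht.1 i
    dist_logAngles_lt := fun t ht n => by
      unfold PlaneGeometry.logAngles
      rw [vertexAngle_eq_of_isNested ht n, dist_self]
      exact hdist _ ht.1
    lt_of_dist_lt := fun ε hε => ⟨ε, hε, fun _ _ h => h 0 1⟩ }

end EuclideanPlane

theorem exists_hasAngleControl_constCurv (κ : ℝ) : ∃ K, HasAngleControl (constCurv κ) K := by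
  rcases lt_trichotomy κ 0 with hneg | rfl | hpos
  · rw [constCurv, if_pos hneg]
    have hscale : 0 < 1 / √(-κ) := one_div_pos.2 (sqrt_pos.2 (neg_pos.2 hneg))
    exact (isModel_hyperbolicPlane.rescale hscale).exists_hasAngleControl
  · rw [constCurv, if_neg (lt_irrefl _), if_pos rfl]
    exact ⟨_, hasAngleControl_euclideanPlane⟩
  · rw [constCurv, if_neg hpos.not_gt, if_neg hpos.ne']
    have hscale : 0 < 1 / √κ := one_div_pos.2 (sqrt_pos.2 hpos)
    exact (isModel_unitSphere.rescale hscale).exists_hasAngleControl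

end MedialSubdivision

end

theorem theoremB (κ : ℝ) :
    ∃ l L : (Fin 3 → (MedialSubdivision.constCurv κ).Point) → Fin 3 → ℝ,
      (∀ t₀, (MedialSubdivision.constCurv κ).IsTriangle t₀ → ∀ i, 0 < l t₀ i ∧ 0 < L t₀ i) ∧
      (∀ t : ℕ → Fin 3 → (MedialSubdivision.constCurv κ).Point,
        (MedialSubdivision.constCurv κ).IsNested t → ∀ (i : Fin 3) (n : ℕ),
          (MedialSubdivision.constCurv κ).vertexAngle (t 0) i * l (t 0) i
              < (MedialSubdivision.constCurv κ).vertexAngle (t n) i ∧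
          (MedialSubdivision.constCurv κ).vertexAngle (t n) i
              < (MedialSubdivision.constCurv κ).vertexAngle (t 0) i * L (t 0) i) ∧
      (∀ ε > (0 : ℝ), ∃ δ > (0 : ℝ), ∀ t₀, (MedialSubdivision.constCurv κ).IsTriangle t₀ →
        (∀ i j, (MedialSubdivision.constCurv κ).dist (t₀ i) (t₀ j) < δ) →
          ∀ i, (1 - ε < l t₀ i ∧ l t₀ i < 1) ∧ (1 < L t₀ i ∧ L t₀ i < 1 + ε)) := by
  obtain ⟨K, hK⟩ := MedialSubdivision.exists_hasAngleControl_constCurv κ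
  refine ⟨fun t₀ _ => Real.exp (-K t₀), fun t₀ _ => Real.exp (K t₀),
    fun t₀ _ _ => ⟨Real.exp_pos _, Real.exp_pos _⟩, fun t ht i n => hK.mul_exp_lt ht i n,
    fun ε hε => ?_⟩
  obtain ⟨δ, hδ, hsmall⟩ := hK.lt_of_dist_lt (Real.log (1 + ε)) (Real.log_pos (by linarith))
  refine ⟨δ, hδ, fun t₀ ht₀ hdist _ => ?_⟩
  have hpos := hK.pos t₀ ht₀
  have hup : Real.exp (K t₀) < 1 + ε :=
    (Real.lt_log_iff_exp_lt (by linarith)).1 (hsmall t₀ ht₀ hdist)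
  exact ⟨⟨MedialSubdivision.one_sub_lt_exp_neg hup, Real.exp_lt_one_iff.2 (neg_lt_zero.2 hpos)⟩,
    Real.one_lt_exp_iff.2 hpos, hup⟩
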